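/- Let $B$ be a $C^*$-algebra with multiplier algebra $M(B)$, and let $p,q\in M(B)$ be projections with $p-q\in B$. Let $\widetilde B=\mathbb C\oplus B$ be the $C^*$-algebra obtained from $B$ by adjoining a unit, and let $K_0(B)=\ker(K_0(\widetilde B)\to K_0(\mathbb C))$. Let $[p:q]\in K_0(B)$ denote the essential codimension of $p$ and $q$: viewing $M(B)$ as a corner of $M(B\otimes\mathcal K)=\mathcal L(H_B)$, $p$ and $q$ are the images of $1$ under a Cuntz pair $\phi,\psi:\mathbb C\to M(B\otimes\mathcal K)$, and $[p:q]$ is the class $[\phi,\psi]\in KK_h(\mathbb C,B)$ (homotopy classes of Cuntz pairs), read in $K_0(B)$ through the canonical isomorphism $K_0(B)\cong KK_h(\mathbb C,B)$ that sends $[e]_0-[f]_0$ to the class of $(e,f)$ for projections $e,f\in M_n(\widetilde B)$ with $e-f\in M_n(B)$. Suppose that $K_0(B)$ is an ordered group whose positive cone is $K_0(B)^+=\{[e]_0 : e \text{ a projection in } M_n(B),\ n\ge 1\}$. Then: (1) If $q\in B$, then $[p:q]\ge -[q]_0$ in $K_0(B)$. (2) If $1-q\in\widetilde B$, then $[p:q]\le[1-q]_0$.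 That is: if $1-q\in B$, the inequality holds in $K_0(B)$; and whenever $1-q$ is the image of a projection $r$ under the canonical map $\widetilde B\to M(B)$, $(z,b)\mapsto z1+b$, one has $[r]_0-[p:q]\in K_0(\widetilde B)^+=\{[e]_0 : e\text{ a projection in } M_n(\widetilde B),\ n\ge 1\}$ in $K_0(\widetilde B)$. -/

import Mathlib

open scoped MultiplierAlgebra Matrix

/-! ## `K₀` of a unital star ring: Murray–von Neumann classes of matrix projections -/

namespace KTheory

section MvN

variable {R : Type*} [Ring R] [StarRing R]

/-- Murray–von Neumann equivalence of square matrices of possibly different sizes: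
`v* v = p` and `v v* = q` for some rectangular matrix `v`. -/
def MvN {ι κ : Type*} [Fintype ι] [Fintype κ] (p : Matrix ι ι R) (q : Matrix κ κ R) : Prop :=
  ∃ v : Matrix κ ι R, vᴴ * v = p ∧ v * vᴴ = q

theorem MvN.symm {ι κ : Type*} [Fintype ι] [Fintype κ] {p : Matrix ι ι R} {q : Matrix κ κ R}
    (h : MvN p q) : MvN q p := by
  obtain ⟨v, h1, h2⟩ := h
  exact ⟨vᴴ, by simpa using h2, by simpa using h1⟩

theorem MvN.refl {ι : Type*} [Fintype ι] {p : Matrix ι ι R} (hp : IsStarProjection p) :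
    MvN p p :=
  ⟨p, by
    have h1 : pᴴ = p := hp.isSelfAdjoint
    rw [h1]
    exact ⟨hp.isIdempotentElem, hp.isIdempotentElem⟩⟩

theorem MvN.trans {ι κ l : Type*} [Fintype ι] [Fintype κ] [Fintype l] {p : Matrix ι ι R}
    {q : Matrix κ κ R} {r : Matrix l l R} (hp : IsStarProjection p) (hr : IsStarProjection r)
    (h : MvN p q) (h' : MvN q r) : MvN p r := by
  obtain ⟨v, h1, h2⟩ := h
  obtain ⟨w, h3, h4⟩ := h'
  refine ⟨w * v, ?_, ?_⟩
  · calc (w * v)ᴴ * (w * v) = vᴴ * (wᴴ * w) * v := by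
          simp only [Matrix.conjTranspose_mul, Matrix.mul_assoc]
      _ = (vᴴ * v) * (vᴴ * v) := by rw [h3, ← h2]; simp only [Matrix.mul_assoc]
      _ = p := by rw [h1]; exact hp.isIdempotentElem
  · calc (w * v) * (w * v)ᴴ = w * (v * vᴴ) * wᴴ := by
          simp only [Matrix.conjTranspose_mul, Matrix.mul_assoc]
      _ = (w * wᴴ) * (w * wᴴ) := by rw [h2, ← h3]; simp only [Matrix.mul_assoc]
      _ = r := by rw [h4]; exact hr.isIdempotentElem

theorem isStarProjection_submatrix {ι κ : Type*} [Fintype ι] [Fintype κ]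
    {p : Matrix ι ι R} (hp : IsStarProjection p) (e : κ ≃ ι) :
    IsStarProjection (p.submatrix e e) := by
  constructor
  · change p.submatrix e e * p.submatrix e e = p.submatrix e e
    rw [Matrix.submatrix_mul_equiv, hp.isIdempotentElem.eq]
  · change (p.submatrix e e)ᴴ = p.submatrix e e
    have h1 : pᴴ = p := hp.isSelfAdjoint
    rw [Matrix.conjTranspose_submatrix, h1]

theorem MvN.submatrix {ι κ : Type*} [Fintype ι] [Fintype κ]
    {p : Matrix ι ι R} (hp : IsStarProjection p) (e : κ ≃ ι) : MvN p (p.submatrix e e) := by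
  have h1 : pᴴ = p := hp.isSelfAdjoint
  have h2 : p * p = p := hp.isIdempotentElem
  refine ⟨p.submatrix e id, ?_, ?_⟩
  · rw [Matrix.conjTranspose_submatrix, h1, Matrix.submatrix_mul_equiv, h2, Matrix.submatrix_id_id]
  · rw [Matrix.conjTranspose_submatrix, h1]
    have := Matrix.submatrix_mul_equiv p p e (Equiv.refl ι) e
    rw [h2] at this
    exact this

/-- Block diagonal sum of two matrices. -/
def blockSum {ι κ : Type*} (p : Matrix ι ι R) (q : Matrix κ κ R) :
    Matrix (ι ⊕ κ) (ι ⊕ κ) R := Matrix.fromBlocks p 0 0 q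

theorem isStarProjection_blockSum {ι κ : Type*} [Fintype ι] [Fintype κ] {p : Matrix ι ι R}
    {q : Matrix κ κ R} (hp : IsStarProjection p) (hq : IsStarProjection q) :
    IsStarProjection (blockSum p q) := by
  have h1 : pᴴ = p := hp.isSelfAdjoint
  have h2 : qᴴ = q := hq.isSelfAdjoint
  constructor
  · change blockSum p q * blockSum p q = blockSum p q
    simp [blockSum, Matrix.fromBlocks_multiply, hp.isIdempotentElem.eq, hq.isIdempotentElem.eq]
  · change (blockSum p q)ᴴ = blockSum p q
    simp [blockSum, Matrix.fromBlocks_conjTranspose, h1, h2]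

theorem MvN.blockSum {ι κ ι' κ' : Type*} [Fintype ι] [Fintype κ] [Fintype ι'] [Fintype κ']
    {p : Matrix ι ι R} {q : Matrix κ κ R} {p' : Matrix ι' ι' R} {q' : Matrix κ' κ' R}
    (h : MvN p p') (h' : MvN q q') : MvN (blockSum p q) (blockSum p' q') := by
  obtain ⟨v, h1, h2⟩ := h
  obtain ⟨w, h3, h4⟩ := h'
  refine ⟨Matrix.fromBlocks v 0 0 w, ?_, ?_⟩ <;>
  simp [KTheory.blockSum, Matrix.fromBlocks_conjTranspose, Matrix.fromBlocks_multiply, *]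

end MvN

/-- `P_∞(R)`: the projections in the matrix algebras `M_n(R)`. -/
structure MatProj (R : Type*) [Ring R] [StarRing R] where
  size : ℕ
  mat : Matrix (Fin size) (Fin size) R
  isProj : IsStarProjection mat

variable {R S : Type*} [Ring R] [StarRing R] [Algebra ℂ R]
  [Ring S] [StarRing S] [Algebra ℂ S]

instance MatProj.setoid (R : Type*) [Ring R] [StarRing R] : Setoid (MatProj R) where
  r p q := MvN p.mat q.mat
  iseqv :=
    { refl := fun p => MvN.refl p.isProj
      symm := MvN.symm
      trans := fun {p _ r} h h' => MvN.trans p.isProj r.isProj h h' }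

/-- The direct sum `p ⊕ q` of matrix projections. -/
def MatProj.sum {R : Type*} [Ring R] [StarRing R] (p q : MatProj R) : MatProj R where
  size := p.size + q.size
  mat := (blockSum p.mat q.mat).submatrix finSumFinEquiv.symm finSumFinEquiv.symm
  isProj := isStarProjection_submatrix (isStarProjection_blockSum p.isProj q.isProj) _

theorem MatProj.sum_mvn {R : Type*} [Ring R] [StarRing R] (p q : MatProj R) :
    MvN (blockSum p.mat q.mat) (p.sum q).mat :=
  MvN.submatrix (isStarProjection_blockSum p.isProj q.isProj) _

/-- The empty projection, of size `0`. -/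
def MatProj.empty (R : Type*) [Ring R] [StarRing R] : MatProj R where
  size := 0
  mat := 0
  isProj := IsStarProjection.zero _

/-- The semigroup of Murray–von Neumann classes of matrix projections. -/
def V (R : Type*) [Ring R] [StarRing R] : Type _ := Quotient (MatProj.setoid R)

/-- The class of a projection in `V`. -/
def V.mk {R : Type*} [Ring R] [StarRing R] (p : MatProj R) : V R :=
  Quotient.mk (MatProj.setoid R) p

theorem MatProj.sum_congr {R : Type*} [Ring R] [StarRing R] {p q p' q' : MatProj R}
    (h : MvN p.mat p'.mat) (h' : MvN q.mat q'.mat) : MvN (p.sum q).mat (p'.sum q').mat :=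
  MvN.trans (p.sum q).isProj (p'.sum q').isProj (MatProj.sum_mvn p q).symm
    (MvN.trans (isStarProjection_blockSum p.isProj q.isProj) (p'.sum q').isProj
      (MvN.blockSum h h') (MatProj.sum_mvn p' q'))

instance (R : Type*) [Ring R] [StarRing R] : Zero (V R) := ⟨V.mk (MatProj.empty R)⟩

instance (R : Type*) [Ring R] [StarRing R] : Add (V R) :=
  ⟨Quotient.map₂ MatProj.sum (fun _ _ h _ _ h' => MatProj.sum_congr h h')⟩

instance (R : Type*) [Ring R] [StarRing R] : AddCommMonoid (V R) where
  nsmul := nsmulRec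
  add_assoc a b c := by
    induction a using Quotient.inductionOn with | h p => ?_
    induction b using Quotient.inductionOn with | h q => ?_
    induction c using Quotient.inductionOn with | h r => ?_
    refine Quotient.sound ?_
    change MvN ((p.sum q).sum r).mat (p.sum (q.sum r)).mat
    have hpq := isStarProjection_blockSum p.isProj q.isProj
    have hqr := isStarProjection_blockSum q.isProj r.isProj
    have h3 := isStarProjection_blockSum hpq r.isProj
    have h3' := isStarProjection_blockSum p.isProj hqr
    have e1 : MvN (blockSum (blockSum p.mat q.mat) r.mat) ((p.sum q).sum r).mat :=
      MvN.trans h3 ((p.sum q).sum r).isProj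
        (MvN.blockSum (MatProj.sum_mvn p q) (MvN.refl r.isProj)) (MatProj.sum_mvn _ _)
    have e2 : MvN (blockSum p.mat (blockSum q.mat r.mat)) (p.sum (q.sum r)).mat :=
      MvN.trans h3' (p.sum (q.sum r)).isProj
        (MvN.blockSum (MvN.refl p.isProj) (MatProj.sum_mvn q r)) (MatProj.sum_mvn _ _)
    have e3 : MvN (blockSum (blockSum p.mat q.mat) r.mat)
        (blockSum p.mat (blockSum q.mat r.mat)) := by
      have := MvN.submatrix h3 (Equiv.sumAssoc (Fin p.size) (Fin q.size) (Fin r.size)).symm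
      convert this using 1
      ext (i | i | i) (j | j | j) <;> simp [blockSum]
    exact MvN.trans ((p.sum q).sum r).isProj (p.sum (q.sum r)).isProj e1.symm
      (MvN.trans h3 (p.sum (q.sum r)).isProj e3 e2)
  zero_add a := by
    induction a using Quotient.inductionOn with | h p => ?_
    refine Quotient.sound ?_
    change MvN ((MatProj.empty R).sum p).mat p.mat
    have h := MvN.submatrix (isStarProjection_blockSum (MatProj.empty R).isProj p.isProj)
      (Equiv.emptySum (Fin 0) (Fin p.size)).symm
    refine MvN.trans ((MatProj.empty R).sum p).isProj p.isProj (MatProj.sum_mvn _ _).symm ?_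
    exact h.symm.symm
  add_zero a := by
    induction a using Quotient.inductionOn with | h p => ?_
    refine Quotient.sound ?_
    change MvN (p.sum (MatProj.empty R)).mat p.mat
    have h := MvN.submatrix (isStarProjection_blockSum p.isProj (MatProj.empty R).isProj)
      (Equiv.sumEmpty (Fin p.size) (Fin 0)).symm
    refine MvN.trans (p.sum (MatProj.empty R)).isProj p.isProj (MatProj.sum_mvn _ _).symm ?_
    exact h.symm.symm
  add_comm a b := by
    induction a using Quotient.inductionOn with | h p => ?_
    induction b using Quotient.inductionOn with | h q => ?_
    refine Quotient.sound ?_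
    change MvN (p.sum q).mat (q.sum p).mat
    have h1 := isStarProjection_blockSum p.isProj q.isProj
    have e3 : MvN (blockSum p.mat q.mat) (blockSum q.mat p.mat) := by
      have := MvN.submatrix h1 (Equiv.sumComm (Fin q.size) (Fin p.size))
      convert this using 1
      ext (i | i) (j | j) <;> simp [blockSum]
    exact MvN.trans (p.sum q).isProj (q.sum p).isProj (MatProj.sum_mvn p q).symm
      (MvN.trans h1 (q.sum p).isProj e3 (MatProj.sum_mvn q p))

/-- Entrywise image of a matrix projection under a star homomorphism. -/
def MatProj.map (f : R →⋆ₐ[ℂ] S) (p : MatProj R) : MatProj S where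
  size := p.size
  mat := p.mat.map f
  isProj := by
    constructor
    · change p.mat.map f * p.mat.map f = p.mat.map f
      rw [← Matrix.map_mul, p.isProj.isIdempotentElem.eq]
    · change (p.mat.map f)ᴴ = p.mat.map f
      have h1 : p.matᴴ = p.mat := p.isProj.isSelfAdjoint
      rw [← Matrix.conjTranspose_map f (fun a => map_star f a), h1]

/-- Functoriality of `V`. -/
def V.map (f : R →⋆ₐ[ℂ] S) : V R →+ V S where
  toFun := Quotient.map (MatProj.map f) (by
    rintro p q ⟨v, h1, h2⟩
    refine ⟨v.map f, ?_, ?_⟩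
    · change (v.map f)ᴴ * v.map f = p.mat.map f
      rw [← Matrix.conjTranspose_map f (fun a => map_star f a), ← Matrix.map_mul, h1]
    · change v.map f * (v.map f)ᴴ = q.mat.map f
      rw [← Matrix.conjTranspose_map f (fun a => map_star f a), ← Matrix.map_mul, h2])
  map_zero' := by
    refine Quotient.sound ?_
    change MvN ((MatProj.empty R).map f).mat (MatProj.empty S).mat
    exact ⟨0, Subsingleton.elim (α := Matrix (Fin 0) (Fin 0) S) _ _,
      Subsingleton.elim (α := Matrix (Fin 0) (Fin 0) S) _ _⟩
  map_add' a b := by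
    induction a using Quotient.inductionOn with | h p => ?_
    induction b using Quotient.inductionOn with | h q => ?_
    refine Quotient.sound ?_
    change MvN ((p.sum q).map f).mat ((p.map f).sum (q.map f)).mat
    have : ((p.sum q).map f).mat = ((p.map f).sum (q.map f)).mat := by
      ext i j
      change f (blockSum p.mat q.mat (finSumFinEquiv.symm i) (finSumFinEquiv.symm j)) =
        blockSum (p.mat.map f) (q.mat.map f) (finSumFinEquiv.symm i) (finSumFinEquiv.symm j)
      rcases finSumFinEquiv.symm i with a | a <;> rcases finSumFinEquiv.symm j with b | b <;>
        simp [blockSum]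
    rw [← this]
    exact MvN.refl ((p.sum q).map f).isProj

/-- `K₀` of a unital star algebra: the Grothendieck group of `V`. -/
abbrev K0Unital (R : Type*) [Ring R] [StarRing R] : Type _ := Algebra.GrothendieckAddGroup (V R)

/-- The class `[p]₀` of a matrix projection over a unital algebra. -/
def K0Unital.cls {R : Type*} [Ring R] [StarRing R] (p : MatProj R) : K0Unital R :=
  Algebra.GrothendieckAddGroup.of (V.mk p)

/-- The positive cone `{[p]₀ : p ∈ P_∞(R)}`. -/
def K0Unital.posCone (R : Type*) [Ring R] [StarRing R] : Set (K0Unital R) :=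
  Set.range K0Unital.cls

/-- Functoriality of `K₀` for unital star homomorphisms. -/
noncomputable def K0Unital.map (f : R →⋆ₐ[ℂ] S) : K0Unital R →+ K0Unital S :=
  Algebra.GrothendieckAddGroup.lift (Algebra.GrothendieckAddGroup.of.comp (V.map f))

theorem K0Unital.map_cls (f : R →⋆ₐ[ℂ] S) (p : MatProj R) :
    K0Unital.map f (K0Unital.cls p) = K0Unital.cls (p.map f) := by
  have h := Algebra.GrothendieckAddGroup.lift.symm_apply_apply
    (Algebra.GrothendieckAddGroup.of.comp (V.map f))
  exact DFunLike.congr_fun h (V.mk p)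

end KTheory

/-! ## `K₀` of a C⋆-algebra, unital or not -/

namespace KTheory

variable {B : Type*} [NonUnitalCStarAlgebra B]

/-- The scalar map `B̃ = ℂ ⊕ B → ℂ`, `(z, b) ↦ z`. -/
noncomputable def scalarHom (B : Type*) [NonUnitalCStarAlgebra B] : Unitization ℂ B →⋆ₐ[ℂ] ℂ :=
  { Unitization.fstHom ℂ B with map_star' := fun x => by simp }

/-- `K₀(B)` is the kernel of `K₀(B̃) → K₀(ℂ)`. -/
noncomputable def K0 (B : Type*) [NonUnitalCStarAlgebra B] :
    AddSubgroup (K0Unital (Unitization ℂ B)) :=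
  (K0Unital.map (scalarHom B)).ker

/-- A projection in `M_n(B)`, seen in `M_n(B̃)`. -/
def inclProj {n : ℕ} (p : Matrix (Fin n) (Fin n) B) (hp : IsStarProjection p) :
    MatProj (Unitization ℂ B) where
  size := n
  mat := p.map (Unitization.inr : B → Unitization ℂ B)
  isProj := by
    constructor
    · change p.map _ * p.map _ = p.map _
      conv_rhs => rw [← hp.isIdempotentElem.eq]
      ext i j : 1
      simp only [Matrix.mul_apply, Matrix.map_apply]
      exact ((map_sum (Unitization.inrNonUnitalStarAlgHom ℂ B) _ _).trans
        (Finset.sum_congr rfl fun k _ => map_mul (Unitization.inrNonUnitalStarAlgHom ℂ B) _ _)).symm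
    · change (p.map _)ᴴ = p.map _
      have h1 : pᴴ = p := hp.isSelfAdjoint
      conv_rhs => rw [← h1]
      ext i j : 1
      simp

/-- The class `[p]₀ ∈ K₀(B)` of a projection `p ∈ M_n(B)`. -/
noncomputable def K0.cls {n : ℕ} (p : Matrix (Fin n) (Fin n) B) (hp : IsStarProjection p) :
    K0 B :=
  ⟨K0Unital.cls (inclProj p hp), by
    change K0Unital.map (scalarHom B) _ = 0
    rw [K0Unital.map_cls]
    have : V.mk ((inclProj p hp).map (scalarHom B)) = 0 := by
      refine Quotient.sound ?_
      have h0 : ((inclProj p hp).map (scalarHom B)).mat = 0 := by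
        ext i j
        exact Unitization.fst_inr ℂ (p i j)
      exact ⟨(0 : Matrix (Fin 0) (Fin n) ℂ), by
          rw [h0]; exact Matrix.mul_zero (0 : Matrix (Fin n) (Fin 0) ℂ),
        Subsingleton.elim (α := Matrix (Fin 0) (Fin 0) ℂ) _ _⟩
    rw [K0Unital.cls, this, map_zero]⟩

/-- The positive cone `K₀(B)⁺ = {[p]₀ : p ∈ P_∞(B)}`. -/
def K0.posCone (B : Type*) [NonUnitalCStarAlgebra B] : Set (K0 B) :=
  {x | ∃ (n : ℕ) (p : Matrix (Fin n) (Fin n) B) (hp : IsStarProjection p), x = K0.cls p hp}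

/-- A projection `p ∈ B` as a `1 × 1` matrix. -/
theorem isStarProjection_one_by_one {R : Type*} [NonUnitalRing R] [StarRing R] {p : R}
    (hp : IsStarProjection p) :
    IsStarProjection (Matrix.of fun _ _ => p : Matrix (Fin 1) (Fin 1) R) := by
  constructor
  · ext i j
    simp [Matrix.mul_apply, hp.isIdempotentElem.eq]
  · ext i j
    exact hp.isSelfAdjoint

/-- The class `[p]₀ ∈ K₀(B)` of a projection `p ∈ B`. -/
noncomputable def K0.ofProj (p : B) (hp : IsStarProjection p) : K0 B :=
  K0.cls (Matrix.of fun _ _ => p : Matrix (Fin 1) (Fin 1) B) (isStarProjection_one_by_one hp)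

/-- The class `[e]₀ ∈ K₀(R)` of a projection `e` of a unital algebra `R`. -/
def K0Unital.ofProj {R : Type*} [Ring R] [StarRing R] (e : R) (he : IsStarProjection e) :
    K0Unital R :=
  K0Unital.cls ⟨1, Matrix.of fun _ _ => e, isStarProjection_one_by_one he⟩

end KTheory

/-! ## The standard Hilbert module `H_B`, its projections and compact operators -/

namespace HilbertMod

variable {B : Type*} [NonUnitalCStarAlgebra B]

theorem summable_of_le {f g : ℕ → B} (hg : Summable g)
    (h : ∀ n, ∃ c : B, f n = star c * c) (h' : ∀ n, ∃ c : B, g n - f n = star c * c) :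
    Summable f := by
  let _ := CStarAlgebra.spectralOrder B
  have _ := CStarAlgebra.spectralOrderedRing B
  have h0 : ∀ n, 0 ≤ f n := fun n => by
    obtain ⟨c, hc⟩ := h n
    rw [hc]; exact star_mul_self_nonneg c
  have h1 : ∀ n, f n ≤ g n := fun n => by
    obtain ⟨c, hc⟩ := h' n
    rw [← sub_nonneg, hc]; exact star_mul_self_nonneg c
  rw [summable_iff_vanishing_norm] at hg ⊢
  intro ε hε
  obtain ⟨s, hs⟩ := hg ε hε
  refine ⟨s, fun t ht => lt_of_le_of_lt ?_ (hs t ht)⟩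
  exact CStarAlgebra.norm_le_norm_of_nonneg_of_le (Finset.sum_nonneg fun i _ => h0 i)
    (Finset.sum_le_sum fun i _ => h1 i)

/-- `ℓ²(B)`: the sequences `x` in `B` such that `∑ xₙ* xₙ` converges in norm. -/
def l2 (B : Type*) [NonUnitalCStarAlgebra B] : Submodule ℂ (ℕ → B) where
  carrier := {x | Summable fun n => star (x n) * x n}
  zero_mem' := by simp [summable_zero]
  add_mem' {x y} hx hy := by
    have hx : Summable fun n => star (x n) * x n := hx
    have hy : Summable fun n => star (y n) * y n := hy
    refine summable_of_le (((hx.add hx).add (hy.add hy))) (fun n => ⟨_, rfl⟩)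
      (fun n => ⟨x n - y n, ?_⟩)
    simp only [Pi.add_apply, star_add, star_sub]
    noncomm_ring
  smul_mem' c x hx := by
    have hx : Summable fun n => star (x n) * x n := hx
    have := hx.const_smul (star c * c)
    refine this.congr fun n => ?_
    simp [smul_mul_smul_comm]

/-- The standard (right) Hilbert `B`-module `H_B = ℓ²(B)`. -/
def HMod (B : Type*) [NonUnitalCStarAlgebra B] : Type _ := l2 B

instance : AddCommGroup (HMod B) := inferInstanceAs (AddCommGroup (l2 B))

noncomputable instance : Module ℂ (HMod B) := inferInstanceAs (Module ℂ (l2 B))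

/-- The `n`-th coordinate of an element of `H_B`. -/
def HMod.coord (x : HMod B) (n : ℕ) : B := x.1 n

/-- The right action of `B` on `H_B`. -/
def HMod.rmul (x : HMod B) (b : B) : HMod B :=
  ⟨fun n => x.coord n * b, by
    have hx : Summable fun n => star (x.1 n) * x.1 n := x.2
    have := (hx.mul_left (star b)).mul_right b
    refine this.congr fun n => ?_
    simp [HMod.coord, mul_assoc]⟩

/-- The `B`-valued inner product `⟨x, y⟩ = ∑ xₙ* yₙ` (a norm-convergent series). -/
noncomputable def HMod.ip (x y : HMod B) : B := ∑' n, star (x.coord n) * y.coord n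

/-- The Hilbert module norm `‖x‖ = ‖⟨x, x⟩‖^{1/2}`. -/
noncomputable instance : Norm (HMod B) := ⟨fun x => √‖x.ip x‖⟩

/-- `P` is a projection in `L(H_B) = M(B ⊗ K)`, the algebra of adjointable operators:
`P` is idempotent and is its own adjoint. (A map that has an adjoint for `⟨·, ·⟩` is
automatically `B`-linear and bounded.) -/
structure IsProj (P : HMod B → HMod B) : Prop where
  idem : ∀ z, P (P z) = P z
  selfAdj : ∀ x y, (P x).ip y = x.ip (P y)

/-- `T` has operator norm at most `c`. -/
def OpNormLE (T : HMod B → HMod B) (c : ℝ) : Prop := ∀ z, ‖T z‖ ≤ c * ‖z‖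

/-- The operator `∑ₖ θ_{xₖ, yₖ}`, where `θ_{x, y} z = x ⟨y, z⟩`. -/
noncomputable def finiteRank {m : ℕ} (x y : Fin m → HMod B) (z : HMod B) : HMod B :=
  ∑ k, (x k).rmul ((y k).ip z)

/-- `T` lies in `K(H_B) = B ⊗ K`, the norm closure of the span of the operators `θ_{x, y}`. -/
def IsCompactOp (T : HMod B → HMod B) : Prop :=
  ∀ ε > 0, ∃ (m : ℕ) (x y : Fin m → HMod B), OpNormLE (fun z => T z - finiteRank x y z) ε

end HilbertMod

/-! ## Cuntz pairs, `KK_h(ℂ, B)` and the essential codimension -/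

namespace KTheory

open HilbertMod

variable {B : Type*} [NonUnitalCStarAlgebra B]

/-- A Cuntz pair from `ℂ` to `B`: two representations `φ, ψ : ℂ → M(B ⊗ K) = L(H_B)` with
`φ - ψ` valued in `B ⊗ K = K(H_B)`. A representation `φ` of `ℂ` is the same thing as
the projection `φ(1)`. -/
structure CuntzPair (B : Type*) [NonUnitalCStarAlgebra B] where
  left : HMod B → HMod B
  right : HMod B → HMod B
  isProj_left : IsProj left
  isProj_right : IsProj right
  isCompact_sub : IsCompactOp fun z => left z - right z

/-- Homotopy of Cuntz pairs: a Cuntz pair `ℂ → M(C([0,1]) ⊗ (B ⊗ K))` with the given ends, i.e.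
a path of Cuntz pairs whose two components are strictly continuous (for bounded self-adjoint
paths in `L(H_B)`: pointwise norm continuous on `H_B`) and whose difference is norm continuous. -/
def CuntzPair.Homotopic (a b : CuntzPair B) : Prop :=
  ∃ γ : unitInterval → CuntzPair B, γ 0 = a ∧ γ 1 = b ∧
    (∀ z t₀, Filter.Tendsto (fun t => ‖(γ t).left z - (γ t₀).left z‖) (nhds t₀) (nhds 0)) ∧
    (∀ z t₀, Filter.Tendsto (fun t => ‖(γ t).right z - (γ t₀).right z‖) (nhds t₀) (nhds 0)) ∧
    ∀ t₀, ∀ ε > 0, ∀ᶠ t in nhds t₀, OpNormLE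
      (fun z => ((γ t).left z - (γ t).right z) - ((γ t₀).left z - (γ t₀).right z)) ε

/-- `KK_h(ℂ, B)`: Cuntz pairs modulo homotopy. -/
def KKh (B : Type*) [NonUnitalCStarAlgebra B] : Type _ :=
  Quot (CuntzPair.Homotopic (B := B))

/-- The class `[φ, ψ]` of a Cuntz pair. -/
def KKh.mk (a : CuntzPair B) : KKh B := Quot.mk _ a

/-- The canonical map `B̃ → M(B)`, `(z, b) ↦ z 1 + b`. -/
noncomputable def toMult (B : Type*) [NonUnitalCStarAlgebra B] :
    Unitization ℂ B →⋆ₐ[ℂ] 𝓜(ℂ, B) :=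
  Unitization.starLift (DoubleCentralizer.coeHom (𝕜 := ℂ) (A := B))

/-- An `n × n` matrix over `M(B)` acting on the first `n` coordinates of `H_B`, and by `0` on the
others: the embedding `M_n(M(B)) = M(B ⊗ M_n) ⊆ M(B ⊗ K)`. -/
noncomputable def cornerOp {n : ℕ} (e : Matrix (Fin n) (Fin n) 𝓜(ℂ, B)) (z : HMod B) : HMod B :=
  ⟨fun i => if h : i < n then ∑ j, (e ⟨i, h⟩ j).fst (z.coord j) else 0, by
    refine summable_of_ne_finset_zero (s := Finset.range n) fun i hi => ?_
    have : ¬ i < n := by simpa using hi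
    simp [this]⟩

theorem cornerOp_coord {n : ℕ} (e : Matrix (Fin n) (Fin n) 𝓜(ℂ, B)) (z : HMod B) (i : Fin n) :
    (cornerOp e z).coord i = ∑ j, (e i j).fst (z.coord j) := by
  change (if h : (i : ℕ) < n then _ else _) = _
  rw [dif_pos i.2]

theorem cornerOp_coord_of_le {n : ℕ} (e : Matrix (Fin n) (Fin n) 𝓜(ℂ, B)) (z : HMod B) {i : ℕ}
    (hi : n ≤ i) : (cornerOp e z).coord i = 0 := by
  change (if h : i < n then _ else _) = _
  rw [dif_neg (by omega)]

theorem hMod_ext {x y : HMod B} (h : ∀ i, x.coord i = y.coord i) : x = y :=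
  Subtype.ext (funext h)

theorem cornerOp_mul {n : ℕ} (e f : Matrix (Fin n) (Fin n) 𝓜(ℂ, B)) (z : HMod B) :
    cornerOp e (cornerOp f z) = cornerOp (e * f) z := by
  refine hMod_ext fun i => ?_
  by_cases hi : i < n
  · have h1 := cornerOp_coord e (cornerOp f z) ⟨i, hi⟩
    have h2 := cornerOp_coord (e * f) z ⟨i, hi⟩
    refine h1.trans (Eq.trans ?_ h2.symm)
    have hs : ∀ (s : Finset (Fin n)) (F : Fin n → 𝓜(ℂ, B)) (b : B),
        (∑ j ∈ s, F j).fst b = ∑ j ∈ s, (F j).fst b := by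
      intro s F b
      induction s using Finset.cons_induction with
      | empty => simp
      | cons a s ha ih => rw [Finset.sum_cons, Finset.sum_cons, ← ih]; rfl
    simp only [cornerOp_coord, map_sum, Matrix.mul_apply, hs]
    rw [Finset.sum_comm]
    rfl
  · rw [cornerOp_coord_of_le _ _ (by omega), cornerOp_coord_of_le _ _ (by omega)]

theorem isProj_cornerOp {n : ℕ} {e : Matrix (Fin n) (Fin n) 𝓜(ℂ, B)} (he : IsStarProjection e) :
    IsProj (cornerOp e) where
  idem z := by rw [cornerOp_mul, he.isIdempotentElem.eq]
  selfAdj x y := by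
    have h1 : (cornerOp e x).ip y = ∑ i : Fin n, star ((cornerOp e x).coord i) * y.coord i := by
      rw [HMod.ip, tsum_eq_sum (s := Finset.range n), Finset.sum_range]
      intro i hi
      rw [cornerOp_coord_of_le e x (by simpa using hi)]
      simp
    have h2 : x.ip (cornerOp e y) = ∑ i : Fin n, star (x.coord i) * (cornerOp e y).coord i := by
      rw [HMod.ip, tsum_eq_sum (s := Finset.range n), Finset.sum_range]
      intro i hi
      rw [cornerOp_coord_of_le e y (by simpa using hi)]
      simp
    have h3 : ∀ i j, star (e j i) = e i j := fun i j => congrFun (congrFun he.isSelfAdjoint i) j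
    rw [h1, h2]
    simp only [cornerOp_coord, star_sum, Finset.sum_mul, Finset.mul_sum]
    rw [Finset.sum_comm]
    refine Finset.sum_congr rfl fun i _ => Finset.sum_congr rfl fun j _ => ?_
    rw [← h3 i j, DoubleCentralizer.star_fst]
    apply star_injective
    simpa using ((e j i).central (star (y.coord j)) (x.coord i)).symm

/-- The vector of `H_B` with coordinate `b` at `i` and `0` elsewhere. -/
def single (i : ℕ) (b : B) : HMod B :=
  ⟨Pi.single i b, by
    refine summable_of_ne_finset_zero (s := {i}) fun j hj => ?_
    have : j ≠ i := by simpa using hj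
    simp [Pi.single_eq_of_ne this]⟩

theorem norm_sq_eq (z : HMod B) : ‖z‖ ^ 2 = ‖z.ip z‖ := Real.sq_sqrt (norm_nonneg _)

theorem norm_coord_le (z : HMod B) (j : ℕ) : ‖z.coord j‖ ≤ ‖z‖ := by
  let _ := CStarAlgebra.spectralOrder B
  have _ := CStarAlgebra.spectralOrderedRing B
  refine abs_le_of_sq_le_sq' ?_ (Real.sqrt_nonneg _) |>.2
  change ‖z.coord j‖ ^ 2 ≤ ‖z‖ ^ 2
  rw [norm_sq_eq, sq, ← CStarRing.norm_star_mul_self]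
  exact CStarAlgebra.norm_le_norm_of_nonneg_of_le (star_mul_self_nonneg _)
    (z.2.le_tsum j fun i _ => star_mul_self_nonneg _)

theorem norm_le_sum {n : ℕ} (z : HMod B) (hz : ∀ i, n ≤ i → z.coord i = 0) :
    ‖z‖ ≤ ∑ i : Fin n, ‖z.coord i‖ := by
  refine abs_le_of_sq_le_sq' ?_ (Finset.sum_nonneg fun _ _ => norm_nonneg _) |>.2
  have h1 : z.ip z = ∑ i : Fin n, star (z.coord i) * z.coord i := by
    rw [HMod.ip, tsum_eq_sum (s := Finset.range n), Finset.sum_range]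
    intro i hi
    rw [hz i (by simpa using hi)]
    simp
  rw [norm_sq_eq, h1]
  calc ‖∑ i : Fin n, star (z.coord i) * z.coord i‖
      ≤ ∑ i : Fin n, ‖z.coord i‖ ^ 2 := by
        refine (norm_sum_le _ _).trans (Finset.sum_le_sum fun i _ => ?_)
        rw [CStarRing.norm_star_mul_self, sq]
    _ ≤ (∑ i : Fin n, ‖z.coord i‖) ^ 2 :=
        Finset.sum_sq_le_sq_sum_of_nonneg fun _ _ => norm_nonneg _

theorem coord_sum {ι : Type*} (s : Finset ι) (F : ι → HMod B) (i : ℕ) :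
    (∑ k ∈ s, F k).coord i = ∑ k ∈ s, (F k).coord i := by
  induction s using Finset.cons_induction with
  | empty => simp only [Finset.sum_empty]; rfl
  | cons a s ha ih => rw [Finset.sum_cons, Finset.sum_cons, ← ih]; rfl

theorem single_ip (j : ℕ) (u : B) (z : HMod B) : (single j u).ip z = star u * z.coord j := by
  rw [HMod.ip, tsum_eq_single j]
  · simp [single, HMod.coord]
  · intro k hk
    simp [single, HMod.coord, Pi.single_eq_of_ne hk]

theorem isCompactOp_of_entries {n : ℕ} (T : HMod B → HMod B) (b : Fin n → Fin n → B)
    (hT : ∀ z (i : Fin n), (T z).coord i = ∑ j, b i j * z.coord j)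
    (hT' : ∀ z i, n ≤ i → (T z).coord i = 0) : IsCompactOp T := by
  intro ε hε
  let _ := CStarAlgebra.spectralOrder B
  have _ := CStarAlgebra.spectralOrderedRing B
  obtain ⟨u, hu⟩ : ∃ u : B, ∀ i j, ‖b i j * u - b i j‖ < ε / (n * n + 1) := by
    have hl := CStarAlgebra.increasingApproximateUnit (A := B)
    have := hl.neBot
    refine Filter.Eventually.exists (f := CStarAlgebra.approximateUnit B) ?_
    rw [Filter.eventually_all]
    intro i
    rw [Filter.eventually_all]
    intro j
    have h := (tendsto_iff_norm_sub_tendsto_zero.1 (hl.tendsto_mul_left (b i j)))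
    exact h.eventually (gt_mem_nhds (by positivity))
  refine ⟨n * n, fun k => single (finProdFinEquiv.symm k).1 (b (finProdFinEquiv.symm k).1
    (finProdFinEquiv.symm k).2), fun k => single (finProdFinEquiv.symm k).2 (star u), fun z => ?_⟩
  have hR : ∀ i : ℕ, (finiteRank (fun k => single (finProdFinEquiv.symm k).1
      (b (finProdFinEquiv.symm k).1 (finProdFinEquiv.symm k).2))
      (fun k => single (finProdFinEquiv.symm k).2 (star u)) z).coord i =
      ∑ a : Fin n, ∑ j : Fin n, (Pi.single (a : ℕ) (b a j) : ℕ → B) i * (u * z.coord j) := by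
    intro i
    rw [finiteRank, coord_sum, ← Fintype.sum_prod_type', ← Equiv.sum_comp finProdFinEquiv]
    refine Finset.sum_congr rfl fun k _ => ?_
    simp only [Equiv.symm_apply_apply, single_ip, star_star]
    rfl
  have hsub : ∀ (x y : HMod B) (i : ℕ), (x - y).coord i = x.coord i - y.coord i :=
    fun _ _ _ => rfl
  refine (norm_le_sum (n := n) _ fun i hi => ?_).trans ?_
  · rw [hsub, hT' z i hi, hR, zero_sub, neg_eq_zero]
    refine Finset.sum_eq_zero fun a _ => Finset.sum_eq_zero fun j _ => ?_
    rw [Pi.single_eq_of_ne (by omega), zero_mul]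
  · have hz : 0 ≤ ‖z‖ := Real.sqrt_nonneg _
    calc _ ≤ ∑ i : Fin n, ∑ j : Fin n, ε / (n * n + 1) * ‖z‖ := by
          refine Finset.sum_le_sum fun i _ => ?_
          rw [hsub, hT z i, hR, Finset.sum_eq_single (f := fun a : Fin n =>
            ∑ j : Fin n, (Pi.single (a : ℕ) (b a j) : ℕ → B) i * (u * z.coord j)) i]
          · rw [← Finset.sum_sub_distrib]
            refine (norm_sum_le _ _).trans (Finset.sum_le_sum fun j _ => ?_)
            rw [Pi.single_eq_same, ← mul_assoc, ← sub_mul]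
            refine (norm_mul_le _ _).trans ?_
            rw [norm_sub_rev]
            exact mul_le_mul (hu i j).le (norm_coord_le z j) (norm_nonneg _) (by positivity)
          · intro a _ ha
            refine Finset.sum_eq_zero fun j _ => ?_
            rw [Pi.single_eq_of_ne (fun h => ha (Fin.ext h.symm)), zero_mul]
          · simp
      _ = (n * n) / (n * n + 1) * ε * ‖z‖ := by
          simp only [Finset.sum_const, Finset.card_univ, Fintype.card_fin, nsmul_eq_mul]
          ring
      _ ≤ ε * ‖z‖ := by
          refine mul_le_mul_of_nonneg_right ?_ hz
          have : ((n : ℝ) * n) / (n * n + 1) ≤ 1 := by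
            rw [div_le_one (by positivity)]
            linarith
          nlinarith

/-- The Cuntz pair given by two projections `e, f` in `M_n(M(B)) ⊆ M(B ⊗ K)` whose difference lies
in `M_n(B)`. -/
noncomputable def CuntzPair.ofMatrix {n : ℕ} (e f : Matrix (Fin n) (Fin n) 𝓜(ℂ, B))
    (he : IsStarProjection e) (hf : IsStarProjection f)
    (hef : ∀ i j, ∃ b : B, (b : 𝓜(ℂ, B)) = e i j - f i j) : CuntzPair B where
  left := cornerOp e
  right := cornerOp f
  isProj_left := isProj_cornerOp he
  isProj_right := isProj_cornerOp hf
  isCompact_sub := by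
    choose b hb using hef
    refine isCompactOp_of_entries _ b (fun z i => ?_) (fun z i hi => ?_)
    · change (cornerOp e z).coord i - (cornerOp f z).coord i = _
      rw [cornerOp_coord, cornerOp_coord, ← Finset.sum_sub_distrib]
      refine Finset.sum_congr rfl fun j _ => ?_
      have := congrArg (fun m : 𝓜(ℂ, B) => m.fst (z.coord j)) (hb i j)
      exact this.symm
    · change (cornerOp e z).coord i - (cornerOp f z).coord i = 0
      rw [cornerOp_coord_of_le e z hi, cornerOp_coord_of_le f z hi, sub_zero]

theorem isStarProjection_map_toMult {n : ℕ} {e : Matrix (Fin n) (Fin n) (Unitization ℂ B)}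
    (he : IsStarProjection e) : IsStarProjection (e.map (toMult B)) :=
  (MatProj.map (toMult B) ⟨n, e, he⟩).isProj

theorem exists_coe_eq_sub {e f : Unitization ℂ B}
    (h : ∃ b : B, e - f = (b : Unitization ℂ B)) :
    ∃ b : B, (b : 𝓜(ℂ, B)) = toMult B e - toMult B f := by
  obtain ⟨b, hb⟩ := h
  refine ⟨b, ?_⟩
  rw [← map_sub, hb]
  exact (DFunLike.congr_fun
    (Unitization.starLift.symm_apply_apply (DoubleCentralizer.coeHom (𝕜 := ℂ) (A := B))) b).symm

/-- The graph of the canonical isomorphism `K₀(B) ≅ KK_h(ℂ, B)`: for projections `e, f ∈ M_n(B̃)`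
with `e - f ∈ M_n(B)`, the element `[e]₀ - [f]₀` of `K₀(B) ⊆ K₀(B̃)` corresponds to the class of
the Cuntz pair `(e, f)`, where `M_n(B̃)` acts through `M_n(B̃) → M_n(M(B)) ⊆ M(B ⊗ K)`. -/
def K0.Corresponds (g : K0 B) (c : KKh B) : Prop :=
  ∃ (n : ℕ) (e f : Matrix (Fin n) (Fin n) (Unitization ℂ B)) (he : IsStarProjection e)
    (hf : IsStarProjection f)
    (hef : ∀ i j, ∃ b : B, e i j - f i j = (b : Unitization ℂ B)),
    (g : K0Unital (Unitization ℂ B)) = K0Unital.cls ⟨n, e, he⟩ - K0Unital.cls ⟨n, f, hf⟩ ∧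
    c = KKh.mk (CuntzPair.ofMatrix (e.map (toMult B)) (f.map (toMult B))
      (isStarProjection_map_toMult he) (isStarProjection_map_toMult hf)
      fun i j => exists_coe_eq_sub (hef i j))

/-- The canonical identification `KK_h(ℂ, B) → K₀(B)`: `c` is sent to the element of `K₀(B)` that
corresponds to it. -/
noncomputable def KKh.toK0 (c : KKh B) : K0 B := Classical.epsilon fun g => K0.Corresponds g c

/-- The class `[φ, ψ] ∈ KK_h(ℂ, B)`, `φ(1) = p`, `ψ(1) = q`, for projections `p, q ∈ M(B)` with
`p - q ∈ B`, where `M(B)` sits in `M(B ⊗ K)` as the corner of the first coordinate. -/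
noncomputable def kkClass (p q : 𝓜(ℂ, B)) (hp : IsStarProjection p) (hq : IsStarProjection q)
    (hpq : ∃ b : B, (b : 𝓜(ℂ, B)) = p - q) : KKh B :=
  KKh.mk (CuntzPair.ofMatrix (Matrix.of fun _ _ => p : Matrix (Fin 1) (Fin 1) 𝓜(ℂ, B))
    (Matrix.of fun _ _ => q) (isStarProjection_one_by_one hp) (isStarProjection_one_by_one hq)
    fun _ _ => hpq)

/-- The (generalized) essential codimension `[p : q] ∈ K₀(B)`. -/
noncomputable def essCodim (p q : 𝓜(ℂ, B)) (hp : IsStarProjection p) (hq : IsStarProjection q)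
    (hpq : ∃ b : B, (b : 𝓜(ℂ, B)) = p - q) : K0 B :=
  KKh.toK0 (kkClass p q hp hq hpq)

end KTheory

/-!
The three inequalities are read off from explicit formulas once the essential codimension is
computed: if `f ∈ B̃` is a projection lifting `q` and `b = p - q ∈ B`, then `e = f + b` is a
projection lifting `p`, and `[p : q] = [e] - [f]` (`coe_essCodim`). For `q ∈ B` this gives
`[p : q] + [q] = [e]` with `e ∈ B`, and for `f = 1 - r` it gives `[r] - [p : q] = [1 - e]`.

The substance is that this value is forced, i.e. that an element of `K₀(B)` is determined by the
class of its Cuntz pair in `KK_h(ℂ, B)` (`K0.Corresponds.unique`). This is shown by attaching to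
every Cuntz pair `(P, Q)` of operators on `H_B` a homotopy-invariant index in `K₀(B̃)`. With the
self-adjoint unitary `w` whose rows are `(Q, 1 - Q)` and `(1 - Q, Q)`, the projection
`w (P ⊕ (1 - Q)) w` equals `(1 ⊕ 0) + w ((P - Q) ⊕ 0) w`, a compact perturbation of the fixed
projection `1 ⊕ 0`. The index is `[p] - [1 ⊕ 0]`, where `p` is any projection matrix over `B̃`
which is the same perturbation up to a small error (`CuntzPair.IsIndex`).

* Such a `p` exists (`CuntzPair.exists_isIndex`): compact operators are approximated by matrices
  over `B`, and an almost idempotent self-adjoint matrix is close to a projection.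
* The index does not depend on `p` (`CuntzPair.IsIndex.unique`), because projections at distance
  less than `1` are Murray–von Neumann equivalent. The comparison of operator norms on `H_B` with
  C⋆-norms of matrices over `B̃` is `norm_blockOp_le` and `norm_le_sum_blockOp`.
* It is constant along homotopies (`CuntzPair.Homotopic.index_eq`): `Q` varies only strongly, but
  the products of `Q` and `1 - Q` with the compact operator `P - Q` vary in norm (`tendsto_blk`),
  so the index is locally constant on `[0, 1]`.
* For matrix projections `e, f` over `B̃` the matrix `w (e ⊕ (1 - f)) w` itself can be used, and the
  index is `[e] + [1 - f] - [1] = [e] - [f]` (`index_ofMatrix`).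
-/

/-! ### The Hilbert module `H_B` -/

namespace HilbertMod

variable {B : Type*} [NonUnitalCStarAlgebra B]

theorem HMod.coord_add (x y : HMod B) (n : ℕ) : (x + y).coord n = x.coord n + y.coord n := rfl

theorem HMod.coord_sub (x y : HMod B) (n : ℕ) : (x - y).coord n = x.coord n - y.coord n := rfl

theorem HMod.coord_smul (c : ℂ) (x : HMod B) (n : ℕ) : (c • x).coord n = c • x.coord n := rfl

theorem HMod.coord_rmul (x : HMod B) (b : B) (n : ℕ) : (x.rmul b).coord n = x.coord n * b := rfl

theorem HMod.summable_ip_self (x : HMod B) : Summable fun n => star (x.coord n) * x.coord n := x.2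

/-- The series defining `⟨x, y⟩` converges, by polarization. -/
theorem HMod.summable_ip (x y : HMod B) : Summable fun n => star (x.coord n) * y.coord n := by
  have h1 := ((x + y).summable_ip_self.sub x.summable_ip_self).sub y.summable_ip_self
  have h2 := (((Complex.I • x + y).summable_ip_self.sub x.summable_ip_self).sub
    y.summable_ip_self).const_smul Complex.I
  refine ((h1.add h2).const_smul (1 / 2 : ℂ)).congr fun n => ?_
  simp only [HMod.coord_add, HMod.coord_smul, star_add, star_smul, add_mul, mul_add, smul_mul_assoc,
    mul_smul_comm, smul_add, smul_sub, smul_smul, Complex.star_def, Complex.conj_I]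
  match_scalars <;> ring_nf <;> (simp [Complex.I_sq]; try norm_num)

theorem HMod.ip_add_right (x y z : HMod B) : x.ip (y + z) = x.ip y + x.ip z := by
  rw [HMod.ip, HMod.ip, HMod.ip, ← (x.summable_ip y).tsum_add (x.summable_ip z)]
  simp only [HMod.coord_add, mul_add]

theorem HMod.ip_sub_right (x y z : HMod B) : x.ip (y - z) = x.ip y - x.ip z := by
  rw [HMod.ip, HMod.ip, HMod.ip, ← (x.summable_ip y).tsum_sub (x.summable_ip z)]
  simp only [HMod.coord_sub, mul_sub]

theorem HMod.ip_smul_right (c : ℂ) (x y : HMod B) : x.ip (c • y) = c • x.ip y := by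
  rw [HMod.ip, HMod.ip, ← (x.summable_ip y).tsum_const_smul c]
  simp only [HMod.coord_smul, mul_smul_comm]

theorem HMod.ip_rmul_right (x y : HMod B) (b : B) : x.ip (y.rmul b) = x.ip y * b := by
  rw [HMod.ip, HMod.ip, ← (x.summable_ip y).tsum_mul_right b]
  simp only [HMod.coord_rmul, mul_assoc]

theorem HMod.star_ip (x y : HMod B) : star (x.ip y) = y.ip x := by
  rw [HMod.ip, HMod.ip, tsum_star]
  simp

theorem HMod.ip_sub_left (x y z : HMod B) : (x - y).ip z = x.ip z - y.ip z := by
  rw [← HMod.star_ip, HMod.ip_sub_right, star_sub, HMod.star_ip, HMod.star_ip]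

theorem HMod.ip_add_left (x y z : HMod B) : (x + y).ip z = x.ip z + y.ip z := by
  rw [← HMod.star_ip, HMod.ip_add_right, star_add, HMod.star_ip, HMod.star_ip]

theorem HMod.ip_smul_left (c : ℂ) (x y : HMod B) : (c • x).ip y = star c • x.ip y := by
  rw [← HMod.star_ip, HMod.ip_smul_right, star_smul, HMod.star_ip]

theorem HMod.ip_rmul_left (x y : HMod B) (b : B) : (x.rmul b).ip y = star b * x.ip y := by
  rw [← HMod.star_ip, HMod.ip_rmul_right, star_mul, HMod.star_ip]

theorem HMod.norm_nonneg (x : HMod B) : 0 ≤ ‖x‖ := Real.sqrt_nonneg _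

theorem HMod.norm_sq (x : HMod B) : ‖x‖ ^ 2 = ‖x.ip x‖ := Real.sq_sqrt (_root_.norm_nonneg _)

theorem HMod.eq_zero_of_ip_self {x : HMod B} (h : x.ip x = 0) : x = 0 := by
  refine KTheory.hMod_ext fun i => ?_
  have h1 := KTheory.norm_coord_le x i
  have h2 : ‖x‖ = 0 := by
    have := x.norm_sq
    rwa [h, norm_zero, sq_eq_zero_iff] at this
  rw [h2] at h1
  exact norm_le_zero_iff.1 h1

/-- The Cauchy–Schwarz inequality in `H_B`. -/
theorem HMod.norm_ip_le (x y : HMod B) : ‖x.ip y‖ ≤ ‖x‖ * ‖y‖ := by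
  let _ := CStarAlgebra.spectralOrder B
  have _ := CStarAlgebra.spectralOrderedRing B
  have nonneg : ∀ z : HMod B, 0 ≤ z.ip z := fun z =>
    tsum_nonneg fun i => star_mul_self_nonneg _
  by_cases hx : ‖x‖ = 0
  · have : x.ip y = 0 := by
      have h0 : x = 0 := HMod.eq_zero_of_ip_self (by
        rw [← norm_eq_zero, ← HMod.norm_sq, hx]; simp)
      have h1 := HMod.ip_smul_left (0 : ℂ) x y
      rwa [zero_smul, star_zero, zero_smul, ← h0] at h1
    rw [this, norm_zero, hx, zero_mul]
  have hpos : 0 < ‖x‖ ^ 2 := by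
    have := x.norm_nonneg
    positivity
  set a := x.ip y with ha
  set t : ℝ := ‖x‖ ^ 2 with ht
  -- expand `0 ≤ ⟨x a - t y, x a - t y⟩` with `a = ⟨x, y⟩` and `t = ‖x‖²`
  have h1 : (0 : B) ≤ star a * x.ip x * a - (2 * t) • (star a * a) + t ^ 2 • y.ip y := by
    have h := nonneg (x.rmul a - (t : ℂ) • y)
    have hs : star a = y.ip x := HMod.star_ip x y
    rw [HMod.ip_sub_left, HMod.ip_sub_right, HMod.ip_sub_right, HMod.ip_rmul_left,
      HMod.ip_rmul_right, HMod.ip_rmul_left, HMod.ip_smul_right, HMod.ip_smul_left,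
      HMod.ip_smul_left, HMod.ip_smul_right, HMod.ip_rmul_right, ← ha, ← hs] at h
    convert h using 1
    simp only [Complex.star_def, Complex.conj_ofReal, mul_smul_comm, Complex.coe_smul]
    rw [← mul_assoc]
    module
  have h2 : star a * x.ip x * a ≤ t • (star a * a) := by
    rw [ht, HMod.norm_sq]
    exact CStarAlgebra.star_left_conjugate_le_norm_smul (hb := (nonneg x).isSelfAdjoint)
  have h3 : t • (star a * a) ≤ t ^ 2 • y.ip y := by
    have h4 : (0 : B) ≤ t • (star a * a) - (2 * t) • (star a * a) + t ^ 2 • y.ip y :=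
      h1.trans (by gcongr)
    rw [← sub_nonneg]
    convert h4 using 1
    module
  have h4 : ‖t • (star a * a)‖ ≤ ‖t ^ 2 • y.ip y‖ :=
    CStarAlgebra.norm_le_norm_of_nonneg_of_le (smul_nonneg hpos.le (star_mul_self_nonneg _)) h3
  rw [norm_smul, norm_smul, CStarRing.norm_star_mul_self, ← HMod.norm_sq,
    Real.norm_of_nonneg hpos.le, Real.norm_of_nonneg (sq_nonneg t), pow_two t, mul_assoc] at h4
  have h5 := le_of_mul_le_mul_left h4 hpos
  rw [ht] at h5
  exact abs_le_of_sq_le_sq' (by nlinarith) (mul_nonneg x.norm_nonneg y.norm_nonneg) |>.2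

/-- The norm of `H_B` given with its definition is a norm in the usual sense. -/
theorem HMod.normedSpaceCore (B : Type*) [NonUnitalCStarAlgebra B] :
    NormedSpace.Core ℂ (HMod B) where
  norm_nonneg := HMod.norm_nonneg
  norm_eq_zero_iff x := by
    refine ⟨fun h => HMod.eq_zero_of_ip_self ?_, fun h => ?_⟩
    · rw [← norm_eq_zero, ← HMod.norm_sq, h]; simp
    · have := HMod.norm_sq x
      have h1 := HMod.ip_smul_left (0 : ℂ) x x
      rw [zero_smul, star_zero, zero_smul, ← h] at h1
      rwa [h1, norm_zero, sq_eq_zero_iff] at this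
  norm_smul c x := by
    refine (sq_eq_sq₀ (HMod.norm_nonneg _) (mul_nonneg (_root_.norm_nonneg _) x.norm_nonneg)).1 ?_
    rw [HMod.norm_sq, HMod.ip_smul_left, HMod.ip_smul_right, norm_smul, norm_smul, norm_star,
      mul_pow, HMod.norm_sq]
    ring
  norm_triangle x y := by
    refine abs_le_of_sq_le_sq' ?_ (add_nonneg x.norm_nonneg y.norm_nonneg) |>.2
    rw [HMod.norm_sq, HMod.ip_add_left, HMod.ip_add_right, HMod.ip_add_right]
    have h1 := HMod.norm_ip_le x y
    have h2 := HMod.norm_ip_le y x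
    have h3 := norm_add_le (x.ip x + x.ip y) (y.ip x + y.ip y)
    have h4 := norm_add_le (x.ip x) (x.ip y)
    have h5 := norm_add_le (y.ip x) (y.ip y)
    rw [← HMod.norm_sq] at h4 h5
    nlinarith

noncomputable instance : NormedAddCommGroup (HMod B) :=
  NormedAddCommGroup.ofCore (HMod.normedSpaceCore B)

noncomputable instance : NormedSpace ℂ (HMod B) := NormedSpace.ofCore (HMod.normedSpaceCore B)

theorem HMod.ext_ip {x y : HMod B} (h : ∀ z : HMod B, z.ip x = z.ip y) : x = y :=
  sub_eq_zero.1 (HMod.eq_zero_of_ip_self (by rw [HMod.ip_sub_right, h, sub_self]))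

/-- The operators on `H_B`. -/
abbrev Op (B : Type*) [NonUnitalCStarAlgebra B] : Type _ := HMod B →L[ℂ] HMod B

theorem Op.mul_apply (S T : Op B) (z : HMod B) : (S * T) z = S (T z) := rfl

theorem Op.add_apply (S T : Op B) (z : HMod B) : (S + T) z = S z + T z := rfl

theorem Op.sub_apply (S T : Op B) (z : HMod B) : (S - T) z = S z - T z := rfl

/-- `T` is the adjoint of `S` for the `B`-valued inner product. -/
def IsAdjointPair (S T : Op B) : Prop := ∀ x y : HMod B, (S x).ip y = x.ip (T y)

/-- An adjoint is bounded by the norm of the operator, by the Cauchy–Schwarz inequality applied to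
`‖T z‖² = ‖⟨z, S T z⟩‖`. -/
theorem IsAdjointPair.norm_le {S T : Op B} (h : IsAdjointPair S T) : ‖T‖ ≤ ‖S‖ := by
  refine T.opNorm_le_bound (norm_nonneg S) fun z => ?_
  by_cases h0 : ‖T z‖ = 0
  · rw [h0]; positivity
  refine le_of_mul_le_mul_right ?_ (lt_of_le_of_ne (norm_nonneg (T z)) (Ne.symm h0))
  rw [← sq, HMod.norm_sq, ← h]
  refine (HMod.norm_ip_le _ _).trans ?_
  rw [mul_assoc, mul_comm ‖z‖, ← mul_assoc]
  exact mul_le_mul_of_nonneg_right (S.le_opNorm _) (norm_nonneg z)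

theorem IsAdjointPair.add {S T S' T' : Op B} (h : IsAdjointPair S T) (h' : IsAdjointPair S' T') :
    IsAdjointPair (S + S') (T + T') := fun x y => by
  rw [Op.add_apply, Op.add_apply, HMod.ip_add_left,
    HMod.ip_add_right, h, h']

theorem IsAdjointPair.sub {S T S' T' : Op B} (h : IsAdjointPair S T) (h' : IsAdjointPair S' T') :
    IsAdjointPair (S - S') (T - T') := fun x y => by
  rw [Op.sub_apply, Op.sub_apply, HMod.ip_sub_left,
    HMod.ip_sub_right, h, h']

theorem IsAdjointPair.mul {S T S' T' : Op B} (h : IsAdjointPair S T) (h' : IsAdjointPair S' T') :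
    IsAdjointPair (S * S') (T' * T) := fun x y => by
  rw [Op.mul_apply, Op.mul_apply, h, h']

theorem IsAdjointPair.one : IsAdjointPair (1 : Op B) 1 := fun _ _ => rfl

/-- A projection of `H_B` as a bounded linear operator: linearity and boundedness both follow
from being its own adjoint. -/
noncomputable def IsProj.toOp {P : HMod B → HMod B} (hP : IsProj P) : Op B :=
  LinearMap.mkContinuous
    { toFun := P
      map_add' := fun x y => HMod.ext_ip fun z => by
        rw [HMod.ip_add_right, ← hP.selfAdj, ← hP.selfAdj, ← hP.selfAdj, HMod.ip_add_right]
      map_smul' := fun c x => HMod.ext_ip fun z => by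
        rw [RingHom.id_apply, HMod.ip_smul_right, ← hP.selfAdj, ← hP.selfAdj,
          HMod.ip_smul_right] } 1 fun z => by
    change ‖P z‖ ≤ 1 * ‖z‖
    by_cases h0 : ‖P z‖ = 0
    · rw [h0]; positivity
    refine le_of_mul_le_mul_right ?_ (lt_of_le_of_ne (norm_nonneg (P z)) (Ne.symm h0))
    rw [← sq, HMod.norm_sq, hP.selfAdj, hP.idem, one_mul]
    exact HMod.norm_ip_le _ _

theorem IsProj.norm_toOp_le {P : HMod B → HMod B} (hP : IsProj P) : ‖hP.toOp‖ ≤ 1 :=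
  LinearMap.mkContinuous_norm_le _ zero_le_one _

theorem IsProj.toOp_mul_self {P : HMod B → HMod B} (hP : IsProj P) :
    hP.toOp * hP.toOp = hP.toOp := ContinuousLinearMap.ext fun z => hP.idem z

theorem IsProj.isAdjointPair {P : HMod B → HMod B} (hP : IsProj P) :
    IsAdjointPair hP.toOp hP.toOp := hP.selfAdj

/-- The rank-one operator `θ_{x, y} z = x ⟨y, z⟩`. -/
noncomputable def theta (x y : HMod B) : Op B :=
  LinearMap.mkContinuous
    { toFun := fun z => x.rmul (y.ip z)
      map_add' := fun z w => KTheory.hMod_ext fun i => by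
        simp only [HMod.coord_rmul, HMod.coord_add, HMod.ip_add_right, mul_add]
      map_smul' := fun c z => KTheory.hMod_ext fun i => by
        simp only [HMod.coord_rmul, HMod.coord_smul, HMod.ip_smul_right, mul_smul_comm,
          RingHom.id_apply] } (‖x‖ * ‖y‖) fun z => by
    change ‖x.rmul (y.ip z)‖ ≤ _
    refine abs_le_of_sq_le_sq' ?_ (by positivity) |>.2
    rw [HMod.norm_sq, HMod.ip_rmul_left, HMod.ip_rmul_right]
    refine (norm_mul_le _ _).trans ?_
    rw [norm_star]
    refine (mul_le_mul_of_nonneg_left (norm_mul_le _ _) (norm_nonneg _)).trans ?_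
    rw [← HMod.norm_sq]
    have := HMod.norm_ip_le y z
    have h2 : ‖y.ip z‖ * ‖y.ip z‖ ≤ (‖y‖ * ‖z‖) * (‖y‖ * ‖z‖) := by gcongr
    nlinarith [mul_le_mul_of_nonneg_left h2 (sq_nonneg ‖x‖)]

theorem theta_apply (x y z : HMod B) : theta x y z = x.rmul (y.ip z) := rfl

theorem norm_theta_le (x y : HMod B) : ‖theta x y‖ ≤ ‖x‖ * ‖y‖ :=
  LinearMap.mkContinuous_norm_le _ (by positivity) _

theorem theta_sub_left (x x' y : HMod B) : theta (x - x') y = theta x y - theta x' y :=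
  ContinuousLinearMap.ext fun z => KTheory.hMod_ext fun i => by
    simp only [Op.sub_apply, theta_apply, HMod.coord_sub, HMod.coord_rmul,
      sub_mul]

theorem theta_sub_right (x y y' : HMod B) : theta x (y - y') = theta x y - theta x y' :=
  ContinuousLinearMap.ext fun z => KTheory.hMod_ext fun i => by
    simp only [Op.sub_apply, theta_apply, HMod.coord_sub, HMod.coord_rmul,
      HMod.ip_sub_left, mul_sub]

/-- An operator with an adjoint is `B`-linear, so it acts on the left vector of `θ_{x, y}`. -/
theorem IsAdjointPair.mul_theta {S T : Op B} (h : IsAdjointPair S T) (x y : HMod B) :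
    S * theta x y = theta (S x) y := by
  refine ContinuousLinearMap.ext fun z => HMod.ext_ip fun w => ?_
  have hT : ∀ v : HMod B, w.ip (S v) = (T w).ip v := fun v => by
    rw [← HMod.star_ip, h, HMod.star_ip]
  rw [Op.mul_apply, theta_apply, theta_apply, hT, HMod.ip_rmul_right, HMod.ip_rmul_right, hT]

theorem IsAdjointPair.theta_mul {S T : Op B} (h : IsAdjointPair S T) (x y : HMod B) :
    theta x y * T = theta x (S y) :=
  ContinuousLinearMap.ext fun z => by
    rw [Op.mul_apply, theta_apply, theta_apply, h]

end HilbertMod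

/-! ### Matrices over `B̃` as operators on `H_B` -/

namespace KTheory

open HilbertMod

variable {B : Type*} [NonUnitalCStarAlgebra B]

theorem toMult_inr (b : B) : toMult B (b : Unitization ℂ B) = (b : 𝓜(ℂ, B)) :=
  DFunLike.congr_fun
    (Unitization.starLift.symm_apply_apply (DoubleCentralizer.coeHom (𝕜 := ℂ) (A := B))) b

/-- Through `B̃ → M(B)`, the algebra `B̃` acts on its ideal `B` by left multiplication. -/
theorem inr_toMult_fst (x : Unitization ℂ B) (b : B) :
    (((toMult B x).fst b : B) : Unitization ℂ B) = x * (b : Unitization ℂ B) := by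
  induction x using Unitization.ind with
  | inl_add_inr c a =>
    have h1 : toMult B (Unitization.inl c) = algebraMap ℂ 𝓜(ℂ, B) c :=
      AlgHomClass.commutes (toMult B) c
    rw [map_add, toMult_inr, h1, add_mul, ← Unitization.inr_mul]
    rw [DoubleCentralizer.add_fst, add_apply, Unitization.inr_add]
    congr 1
    rw [DoubleCentralizer.algebraMap_fst]
    simp [Algebra.algebraMap_eq_smul_one, Unitization.inl_mul_inr]

theorem inr_sum {ι : Type*} (s : Finset ι) (F : ι → B) :
    ((∑ i ∈ s, F i : B) : Unitization ℂ B) = ∑ i ∈ s, (F i : Unitization ℂ B) :=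
  map_sum (Unitization.inrNonUnitalStarAlgHom ℂ B) _ _

theorem fst_sub (x y : Unitization ℂ B) : (x - y).fst = x.fst - y.fst := rfl

theorem fst_sum {ι : Type*} (s : Finset ι) (F : ι → Unitization ℂ B) :
    (∑ i ∈ s, F i).fst = ∑ i ∈ s, (F i).fst :=
  map_sum (Unitization.fstHom ℂ B) _ _

theorem fst_matrix_mul {ι : Type*} [Fintype ι] (x y : Matrix ι ι (Unitization ℂ B)) (k l : ι) :
    ((x * y) k l).fst = ∑ s, (x k s).fst * (y s l).fst := by
  rw [Matrix.mul_apply, fst_sum]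
  exact Finset.sum_congr rfl fun s _ => Unitization.fst_mul _ _

/-- The operator on `H_B` given by an `n × n` matrix over `B̃`, acting on the first `n`
coordinates. -/
noncomputable def matOp {n : ℕ} (x : Matrix (Fin n) (Fin n) (Unitization ℂ B)) : Op B :=
  LinearMap.mkContinuous
    { toFun := cornerOp (x.map (toMult B))
      map_add' := fun u v => hMod_ext fun i => by
        by_cases hi : i < n
        · rw [HMod.coord_add]
          simp only [cornerOp_coord _ _ (⟨i, hi⟩ : Fin n), HMod.coord_add, map_add,
            Finset.sum_add_distrib]
        · rw [HMod.coord_add]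
          simp only [cornerOp_coord_of_le _ _ (not_lt.1 hi), add_zero]
      map_smul' := fun c u => hMod_ext fun i => by
        rw [RingHom.id_apply, HMod.coord_smul]
        by_cases hi : i < n
        · simp only [cornerOp_coord _ _ (⟨i, hi⟩ : Fin n), HMod.coord_smul, map_smul,
            Finset.smul_sum]
        · simp only [cornerOp_coord_of_le _ _ (not_lt.1 hi), smul_zero] }
    (∑ i, ∑ j, ‖(toMult B (x i j)).fst‖) fun z => by
    change ‖cornerOp (x.map (toMult B)) z‖ ≤ _
    refine (norm_le_sum _ fun i hi => cornerOp_coord_of_le _ _ hi).trans ?_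
    rw [Finset.sum_mul]
    refine Finset.sum_le_sum fun i _ => ?_
    rw [cornerOp_coord, Finset.sum_mul]
    refine (norm_sum_le _ _).trans (Finset.sum_le_sum fun j _ => ?_)
    refine (ContinuousLinearMap.le_opNorm _ _).trans ?_
    exact mul_le_mul_of_nonneg_left (norm_coord_le z j) (norm_nonneg _)

theorem matOp_apply {n : ℕ} (x : Matrix (Fin n) (Fin n) (Unitization ℂ B)) (z : HMod B) :
    matOp x z = cornerOp (x.map (toMult B)) z := rfl

theorem matOp_coord_of_le {n : ℕ} (x : Matrix (Fin n) (Fin n) (Unitization ℂ B)) (z : HMod B)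
    {i : ℕ} (hi : n ≤ i) : (matOp x z).coord i = 0 := cornerOp_coord_of_le _ _ hi

theorem inr_matOp_coord {n : ℕ} (x : Matrix (Fin n) (Fin n) (Unitization ℂ B)) (z : HMod B)
    (i : Fin n) : (((matOp x z).coord i : B) : Unitization ℂ B) =
      ∑ j, x i j * ((z.coord j : B) : Unitization ℂ B) := by
  rw [matOp_apply, cornerOp_coord]
  rw [inr_sum]
  exact Finset.sum_congr rfl fun j _ => inr_toMult_fst _ _

theorem matOp_ext {n : ℕ} {x : Matrix (Fin n) (Fin n) (Unitization ℂ B)} {z w : HMod B}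
    (h : ∀ i : Fin n, ∑ j, x i j * ((z.coord j : B) : Unitization ℂ B) =
      ((w.coord i : B) : Unitization ℂ B)) (h' : ∀ i, n ≤ i → w.coord i = 0) :
    matOp x z = w := by
  refine hMod_ext fun i => ?_
  by_cases hi : i < n
  · exact Unitization.inr_injective (R := ℂ) ((inr_matOp_coord x z ⟨i, hi⟩).trans (h ⟨i, hi⟩))
  · rw [matOp_coord_of_le _ _ (not_lt.1 hi), h' _ (not_lt.1 hi)]

theorem matOp_add {n : ℕ} (x y : Matrix (Fin n) (Fin n) (Unitization ℂ B)) :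
    matOp (x + y) = matOp x + matOp y := by
  refine ContinuousLinearMap.ext fun z => matOp_ext (fun i => ?_) fun i hi => ?_
  · rw [Op.add_apply, HMod.coord_add, Unitization.inr_add, inr_matOp_coord, inr_matOp_coord,
      ← Finset.sum_add_distrib]
    simp only [Matrix.add_apply, add_mul]
  · rw [Op.add_apply, HMod.coord_add, matOp_coord_of_le _ _ hi, matOp_coord_of_le _ _ hi, add_zero]

theorem matOp_smul {n : ℕ} (c : ℂ) (x : Matrix (Fin n) (Fin n) (Unitization ℂ B)) :
    matOp (c • x) = c • matOp x := by
  refine ContinuousLinearMap.ext fun z => matOp_ext (fun i => ?_) fun i hi => ?_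
  · change _ = ((c • (matOp x z).coord i : B) : Unitization ℂ B)
    rw [Unitization.inr_smul, inr_matOp_coord, Finset.smul_sum]
    simp only [Matrix.smul_apply, smul_mul_assoc]
  · change c • (matOp x z).coord i = 0
    rw [matOp_coord_of_le _ _ hi, smul_zero]

theorem matOp_sub {n : ℕ} (x y : Matrix (Fin n) (Fin n) (Unitization ℂ B)) :
    matOp (x - y) = matOp x - matOp y := by
  rw [sub_eq_add_neg, ← neg_one_smul ℂ, matOp_add, matOp_smul, neg_one_smul, ← sub_eq_add_neg]

theorem matOp_mul {n : ℕ} (x y : Matrix (Fin n) (Fin n) (Unitization ℂ B)) :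
    matOp (x * y) = matOp x * matOp y := by
  refine ContinuousLinearMap.ext fun z => ?_
  rw [Op.mul_apply, matOp_apply, matOp_apply, matOp_apply, cornerOp_mul, Matrix.map_mul]

theorem isAdjointPair_matOp {n : ℕ} (x : Matrix (Fin n) (Fin n) (Unitization ℂ B)) :
    IsAdjointPair (matOp x) (matOp xᴴ) := fun u v => by
  have h1 : (matOp x u).ip v = ∑ i : Fin n, star ((matOp x u).coord i) * v.coord i := by
    rw [HMod.ip, tsum_eq_sum (s := Finset.range n), Finset.sum_range]
    intro i hi
    rw [matOp_coord_of_le x u (by simpa using hi), star_zero, zero_mul]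
  have h2 : u.ip (matOp xᴴ v) = ∑ i : Fin n, star (u.coord i) * (matOp xᴴ v).coord i := by
    rw [HMod.ip, tsum_eq_sum (s := Finset.range n), Finset.sum_range]
    intro i hi
    rw [matOp_coord_of_le _ v (by simpa using hi), mul_zero]
  refine Unitization.inr_injective (R := ℂ) ?_
  rw [h1, h2, inr_sum, inr_sum]
  simp only [Unitization.inr_mul, Unitization.inr_star, inr_matOp_coord, star_sum, star_mul,
    Finset.sum_mul, Finset.mul_sum, Matrix.conjTranspose_apply]
  rw [Finset.sum_comm]
  simp only [mul_assoc]

end KTheory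

/-! ### Projections in C⋆-algebras -/

section Projections

variable {A : Type*} [CStarAlgebra A]

/-- Projections at distance less than `1` are Murray–von Neumann equivalent: with
`z = qp + (1 - q)(1 - p)`, both `z* z` and `z z*` equal `1 - (p - q)²`, which is positive and
invertible, and the partial isometry is `z (z* z)^{-1/2} p`. -/
theorem IsStarProjection.exists_partialIsometry {p q : A} (hp : IsStarProjection p)
    (hq : IsStarProjection q) (h : ‖p - q‖ < 1) : ∃ v : A, star v * v = p ∧ v * star v = q := by
  let _ := CStarAlgebra.spectralOrder A
  have _ := CStarAlgebra.spectralOrderedRing A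
  have hp1 : p * p = p := hp.isIdempotentElem
  have hq1 : q * q = q := hq.isIdempotentElem
  have hp2 : star p = p := hp.isSelfAdjoint
  have hq2 : star q = q := hq.isSelfAdjoint
  have hp3 : ∀ a, p * (p * a) = p * a := fun a => by rw [← mul_assoc, hp1]
  have hq3 : ∀ a, q * (q * a) = q * a := fun a => by rw [← mul_assoc, hq1]
  set z : A := q * p + (1 - q) * (1 - p) with hz
  set a : A := 1 - (p - q) * (p - q) with ha
  have hsz : star z = p * q + (1 - p) * (1 - q) := by
    simp [hz, hp2, hq2]
  have hza : star z * z = a := by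
    rw [hsz, hz, ha]
    noncomm_ring
    simp only [hp1, hq1, hq3]
    abel
  have haz : z * star z = a := by
    rw [hsz, hz, ha]
    noncomm_ring
    simp only [hp1, hq1, hp3]
    abel
  have hzp : z * p = q * z := by
    rw [hz]
    noncomm_ring
    simp only [hp1, hq1, hq3]
    abel
  have hap : Commute p a := by
    rw [commute_iff_eq, ha]
    noncomm_ring
    simp only [hp1, hq1, hp3, hq3]
    abel
  have hu : IsUnit a := by
    refine isUnit_one_sub_of_norm_lt_one ?_
    calc ‖(p - q) * (p - q)‖ ≤ ‖p - q‖ * ‖p - q‖ := norm_mul_le _ _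
      _ < 1 := by nlinarith [norm_nonneg (p - q)]
  obtain ⟨u, hu⟩ := hu
  set c : A := ((u⁻¹ : Aˣ) : A) with hc
  have hca : c * a = 1 := by rw [← hu, hc]; simp
  have hac : a * c = 1 := by rw [← hu, hc]; simp
  have hc0 : 0 ≤ c := by
    have hsa : star a = a := by rw [← hza]; simp
    have hsc : star c = c := by
      have h1 : star c * a = 1 := by rw [← hsa, ← star_mul, hac, star_one]
      calc star c = star c * (a * c) := by rw [hac, mul_one]
        _ = c := by rw [← mul_assoc, h1, one_mul]
    have : c = star (z * c) * (z * c) := by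
      rw [star_mul, hsc]
      calc c = c * (a * c) := by rw [hac, mul_one]
        _ = _ := by rw [← hza]; simp only [mul_assoc]
    rw [this]
    exact star_mul_self_nonneg _
  have hcp : Commute p c := by
    rw [commute_iff_eq]
    calc p * c = c * a * p * c := by rw [hca, one_mul]
      _ = c * (p * a) * c := by rw [hap.eq]; simp only [mul_assoc]
      _ = c * p := by rw [mul_assoc, mul_assoc, hac, mul_one]
  have hzc : z * c * star z = 1 := by
    have h1 : z * a = a * z := by rw [← hza, ← mul_assoc, haz, hza]
    have h2 : z * c = c * z := by
      calc z * c = c * (a * z) * c := by rw [← mul_assoc, hca, one_mul]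
        _ = c * z := by rw [← h1, mul_assoc, mul_assoc, hac, mul_one]
    rw [h2, mul_assoc, haz, hca]
  set b : A := CFC.sqrt c with hb
  have hbb : b * b = c := CFC.sqrt_mul_sqrt_self c hc0
  have hsb : star b = b := (CFC.sqrt_nonneg c).isSelfAdjoint
  have hbp : Commute b p := by
    rw [hb, CFC.sqrt_eq_cfc]
    exact hcp.symm.cfc_nnreal _
  have hbc : b * a * b = 1 := by
    have hba : Commute b a := by
      have : Commute b c := by
        rw [commute_iff_eq, ← hbb, mul_assoc]
      rw [commute_iff_eq]
      calc b * a = a * c * b * a := by rw [hac, one_mul]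
        _ = a * (b * c) * a := by rw [this.eq]; simp only [mul_assoc]
        _ = a * b := by rw [mul_assoc, mul_assoc, hca, mul_one]
    rw [hba.eq, mul_assoc, hbb, hac]
  refine ⟨z * b * p, ?_, ?_⟩
  · calc star (z * b * p) * (z * b * p) = p * (b * (star z * z) * b) * p := by
          simp only [star_mul, hp2, hsb, mul_assoc]
      _ = p := by rw [hza, hbc, mul_one, hp1]
  · calc z * b * p * star (z * b * p) = z * (b * (p * p) * b) * star z := by
          simp only [star_mul, hp2, hsb, mul_assoc]
      _ = z * (p * (b * b)) * star z := by rw [hp1, hbp.eq, mul_assoc p]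
      _ = (z * p) * c * star z := by rw [hbb]; simp only [mul_assoc]
      _ = q := by rw [hzp, mul_assoc q, mul_assoc q, hzc, mul_one]

/-- A self-adjoint element `x` with `x² - x` small is close to a projection, which differs from `x`
by a multiple of `x² - x`. -/
theorem IsSelfAdjoint.exists_isStarProjection {x : A} (hx : IsSelfAdjoint x)
    (h : ‖x * x - x‖ < 1 / 4) :
    ∃ y : A, IsStarProjection (x + (x * x - x) * y) ∧ ‖y‖ ≤ 2 := by
  have hsp : ∀ s ∈ spectrum ℝ x, |s * s - s| < 1 / 4 := fun s hs => by
    have h1 : cfc (fun s : ℝ => s * s - s) x = x * x - x := by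
      rw [cfc_sub (fun s : ℝ => s * s) (fun s => s) x, cfc_mul (fun s : ℝ => s) (fun s => s) x,
        cfc_id' ℝ x]
    rw [← h1] at h
    exact (norm_apply_le_norm_cfc (fun s : ℝ => s * s - s) x hs).trans_lt h
  have hne : ∀ s ∈ spectrum ℝ x, s ≠ 1 / 2 := fun s hs h0 => by
    have := hsp s hs
    rw [h0] at this
    norm_num [abs_lt] at this
  -- on the spectrum, `s + (s² - s) g s` is the indicator function of `s > 1/2`
  set g : ℝ → ℝ := fun s => if s < 1 / 2 then (1 - s)⁻¹ else -s⁻¹ with hg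
  have hgc : ContinuousOn g (spectrum ℝ x) := by
    intro s hs
    rcases lt_or_gt_of_ne (hne s hs) with hlt | hgt
    · have h1 : ContinuousAt (fun s : ℝ => (1 - s)⁻¹) s :=
        (continuousAt_const.sub continuousAt_id).inv₀ (by linarith : (0 : ℝ) < 1 - s).ne'
      refine (h1.congr ?_).continuousWithinAt
      filter_upwards [Iio_mem_nhds hlt] with t ht
      exact (if_pos ht).symm
    · have h1 : ContinuousAt (fun s : ℝ => -s⁻¹) s :=
        (continuousAt_id.inv₀ (by linarith : (0 : ℝ) < s).ne').neg
      refine (h1.congr ?_).continuousWithinAt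
      filter_upwards [Ioi_mem_nhds hgt] with t ht
      exact (if_neg (not_lt.2 (le_of_lt ht))).symm
  have hfc : ContinuousOn (fun s : ℝ => s + (s * s - s) * g s) (spectrum ℝ x) := by fun_prop
  have hval : ∀ s, s ≠ 1 / 2 → s + (s * s - s) * g s = 0 ∨ s + (s * s - s) * g s = 1 := by
    intro s hs
    rcases lt_or_gt_of_ne hs with hlt | hgt
    · left
      have : (1 - s) ≠ 0 := (by linarith : (0 : ℝ) < 1 - s).ne'
      simp only [hg, if_pos hlt]
      field_simp
      ring
    · right
      have : s ≠ 0 := (by linarith : (0 : ℝ) < s).ne'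
      simp only [hg, if_neg (not_lt.2 hgt.le)]
      field_simp
      ring
  have heq : x + (x * x - x) * cfc g x = cfc (fun s : ℝ => s + (s * s - s) * g s) x := by
    rw [cfc_add x (fun s : ℝ => s) (fun s => (s * s - s) * g s),
      cfc_mul (fun s : ℝ => s * s - s) g x, cfc_sub (fun s : ℝ => s * s) (fun s => s) x,
      cfc_mul (fun s : ℝ => s) (fun s => s) x, cfc_id' ℝ x]
  refine ⟨cfc g x, ?_, norm_cfc_le zero_le_two fun s hs => ?_⟩
  · rw [heq]
    refine ⟨?_, cfc_predicate _ _⟩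
    change _ * _ = _
    rw [← cfc_mul _ _ x hfc hfc]
    refine cfc_congr fun s hs => ?_
    rcases hval s (hne s hs) with h1 | h1 <;> simp only [h1] <;> norm_num
  · rw [Real.norm_eq_abs]
    rcases lt_or_gt_of_ne (hne s hs) with hlt | hgt
    · simp only [hg, if_pos hlt]
      rw [abs_of_pos (inv_pos.2 (by linarith))]
      exact inv_le_of_inv_le₀ (by norm_num) (by linarith)
    · simp only [hg, if_neg (not_lt.2 hgt.le)]
      rw [abs_neg, abs_of_pos (inv_pos.2 (by linarith))]
      exact inv_le_of_inv_le₀ (by norm_num) (by linarith)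

end Projections

/-! ### Operator norms and matrix norms -/

namespace KTheory

open HilbertMod

variable {B : Type*} [NonUnitalCStarAlgebra B]

/-- The `(i, j)` block of a `2 × 2` block matrix, as an operator on `H_B`. -/
noncomputable def blockOp {n : ℕ} (x : Matrix (Fin 2 × Fin n) (Fin 2 × Fin n) (Unitization ℂ B))
    (i j : Fin 2) : Op B := matOp (Matrix.of fun a b => x (i, a) (j, b))

/-- The row vector `(u₀*, u₁*)` over `B̃` formed from the first `n` coordinates of two vectors of
`H_B`. Stars are taken because `CStarMatrix` acts on row vectors, with norm `‖∑ vᵢ vᵢ*‖^{1/2}`. -/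
def rowVec (n : ℕ) (u : Fin 2 → HMod B) :
    WithCStarModule (Unitization ℂ B) (Fin 2 × Fin n → Unitization ℂ B) :=
  (WithCStarModule.equiv _ _).symm fun k => star (((u k.1).coord k.2 : B) : Unitization ℂ B)

theorem norm_sq_of_support {n : ℕ} {z : HMod B} (hz : ∀ i, n ≤ i → z.coord i = 0) :
    ‖z‖ ^ 2 = ‖∑ i : Fin n, star (z.coord i) * z.coord i‖ := by
  rw [HMod.norm_sq, HMod.ip, tsum_eq_sum (s := Finset.range n), Finset.sum_range]
  intro i hi
  rw [hz i (by simpa using hi), mul_zero]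

theorem norm_sum_coord_le (n : ℕ) (z : HMod B) :
    ‖∑ i : Fin n, star (z.coord i) * z.coord i‖ ≤ ‖z‖ ^ 2 := by
  let _ := CStarAlgebra.spectralOrder B
  have _ := CStarAlgebra.spectralOrderedRing B
  rw [HMod.norm_sq, ← Finset.sum_range fun i => star (z.coord i) * z.coord i]
  exact CStarAlgebra.norm_le_norm_of_nonneg_of_le
    (Finset.sum_nonneg fun _ _ => star_mul_self_nonneg _)
    (z.summable_ip_self.sum_le_tsum _ fun i _ => star_mul_self_nonneg _)

theorem toCLM_rowVec {n : ℕ} (x : Matrix (Fin 2 × Fin n) (Fin 2 × Fin n) (Unitization ℂ B))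
    (u : Fin 2 → HMod B) : CStarMatrix.toCLM (CStarMatrix.ofMatrix xᴴ) (rowVec n u) =
      rowVec n fun i => ∑ j, blockOp x i j (u j) := by
  rw [CStarMatrix.toCLM_apply_eq_sum]
  congr 1
  funext k
  obtain ⟨i, a⟩ := k
  change ∑ l : Fin 2 × Fin n, star _ * star (x (i, a) l) = star _
  rw [coord_sum]
  rw [inr_sum, star_sum, Fintype.sum_prod_type]
  refine Finset.sum_congr rfl fun j _ => ?_
  rw [blockOp, inr_matOp_coord, star_sum]
  refine Finset.sum_congr rfl fun b _ => ?_
  rw [star_mul]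
  rfl

section

variable [PartialOrder (Unitization ℂ B)] [StarOrderedRing (Unitization ℂ B)]

theorem norm_rowVec_sq (n : ℕ) (u : Fin 2 → HMod B) : ‖rowVec n u‖ ^ 2 =
    ‖∑ k, ∑ i : Fin n, star ((u k).coord i) * (u k).coord i‖ := by
  rw [WithCStarModule.pi_norm_sq, Fintype.sum_prod_type,
    ← Unitization.norm_inr (𝕜 := ℂ) (∑ k, ∑ i : Fin n, star ((u k).coord i) * (u k).coord i)]
  refine congrArg (fun a : Unitization ℂ B => ‖a‖) ?_
  refine Eq.trans ?_ (inr_sum _ _).symm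
  refine Finset.sum_congr rfl fun k _ => ?_
  refine Eq.trans ?_ (inr_sum _ _).symm
  refine Finset.sum_congr rfl fun i _ => ?_
  rw [WithCStarModule.inner_def]
  change star _ * star (star _) = ((_ : B) : Unitization ℂ B)
  rw [star_star, Unitization.inr_mul, Unitization.inr_star]

theorem norm_rowVec_le (n : ℕ) (u : Fin 2 → HMod B) : ‖rowVec n u‖ ≤ ∑ k, ‖u k‖ := by
  refine abs_le_of_sq_le_sq' ?_ (Finset.sum_nonneg fun _ _ => norm_nonneg _) |>.2
  rw [norm_rowVec_sq]
  refine (norm_sum_le _ _).trans ((Finset.sum_le_sum fun k _ => norm_sum_coord_le n (u k)).trans ?_)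
  exact Finset.sum_sq_le_sq_sum_of_nonneg fun _ _ => norm_nonneg _

theorem norm_le_norm_rowVec {n : ℕ} {u : Fin 2 → HMod B} (k : Fin 2)
    (hu : ∀ i, n ≤ i → (u k).coord i = 0) : ‖u k‖ ≤ ‖rowVec n u‖ := by
  let _ := CStarAlgebra.spectralOrder B
  have _ := CStarAlgebra.spectralOrderedRing B
  refine abs_le_of_sq_le_sq' ?_ (norm_nonneg _) |>.2
  rw [norm_rowVec_sq, norm_sq_of_support hu]
  have h0 : ∀ k, 0 ≤ ∑ i : Fin n, star ((u k).coord i) * (u k).coord i := fun k =>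
    Finset.sum_nonneg fun _ _ => star_mul_self_nonneg _
  exact CStarAlgebra.norm_le_norm_of_nonneg_of_le (h0 k)
    (Finset.single_le_sum (f := fun k => ∑ i : Fin n, star ((u k).coord i) * (u k).coord i)
      (fun k _ => h0 k) (Finset.mem_univ k))

/-- The blocks of a matrix act on `H_B` with norm at most the C⋆-norm of the matrix, whatever its
size. -/
theorem norm_blockOp_le {n : ℕ} (x : Matrix (Fin 2 × Fin n) (Fin 2 × Fin n) (Unitization ℂ B))
    (i j : Fin 2) : ‖blockOp x i j‖ ≤ ‖CStarMatrix.ofMatrix x‖ := by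
  refine ContinuousLinearMap.opNorm_le_bound _ (norm_nonneg _) fun z => ?_
  set u : Fin 2 → HMod B := Pi.single j z with hu
  have h1 : ∀ i, ∑ j, blockOp x i j (u j) = blockOp x i j z := fun i => by
    rw [Finset.sum_eq_single j, hu, Pi.single_eq_same]
    · intro k _ hk
      rw [hu, Pi.single_eq_of_ne hk, map_zero]
    · simp
  have h2 := toCLM_rowVec x u
  simp only [h1] at h2
  have h3 : ‖rowVec n u‖ ≤ ‖z‖ := by
    refine (norm_rowVec_le n u).trans (le_of_eq ?_)
    rw [Finset.sum_eq_single j, hu, Pi.single_eq_same]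
    · intro k _ hk
      rw [hu, Pi.single_eq_of_ne hk, norm_zero]
    · simp
  calc ‖blockOp x i j z‖ ≤ ‖rowVec n fun i => blockOp x i j z‖ :=
        norm_le_norm_rowVec (u := fun i => blockOp x i j z) i
          fun a ha => matOp_coord_of_le _ _ ha
    _ ≤ ‖CStarMatrix.toCLM (CStarMatrix.ofMatrix xᴴ)‖ * ‖rowVec n u‖ := by
        rw [← h2]
        exact ContinuousLinearMap.le_opNorm _ _
    _ ≤ ‖CStarMatrix.ofMatrix x‖ * ‖z‖ := by
        refine mul_le_mul (le_of_eq ?_) h3 (norm_nonneg _) (norm_nonneg _)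
        rw [← CStarMatrix.norm_def]
        exact norm_star (CStarMatrix.ofMatrix x)

/-- For a self-adjoint `x` with entries in the ideal `B`, the norm is controlled by the blocks as
operators on `H_B`, because `x v` has entries in `B` for every vector `v` over `B̃`. -/
theorem norm_le_sum_blockOp {n : ℕ} {x : Matrix (Fin 2 × Fin n) (Fin 2 × Fin n) (Unitization ℂ B)}
    (hx : xᴴ = x) (hB : ∀ k l, (x k l).fst = 0) :
    ‖CStarMatrix.ofMatrix x‖ ≤ ∑ i, ∑ j, ‖blockOp x i j‖ := by
  set X := CStarMatrix.ofMatrix x with hX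
  set c := ∑ i, ∑ j, ‖blockOp x i j‖ with hc
  have hc0 : 0 ≤ c := Finset.sum_nonneg fun _ _ => Finset.sum_nonneg fun _ _ => norm_nonneg _
  have hrow : ∀ v, ∃ u : Fin 2 → HMod B, (∀ k i, n ≤ i → (u k).coord i = 0) ∧
      CStarMatrix.toCLM X v = rowVec n u := fun v => by
    have h0 : ∀ k, (CStarMatrix.toCLM X v k).fst = 0 := fun k => by
      rw [CStarMatrix.toCLM_apply_eq_sum]
      change (∑ l, v l * x l k).fst = 0
      rw [fst_sum]
      refine Finset.sum_eq_zero fun l _ => ?_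
      rw [Unitization.fst_mul, hB l k, mul_zero]
    refine ⟨fun k => ⟨fun i =>
        if h : i < n then star (CStarMatrix.toCLM X v (k, ⟨i, h⟩)).snd else 0,
      summable_of_ne_finset_zero (s := Finset.range n) fun i hi => ?_⟩, fun k i hi => ?_, ?_⟩
    · have : ¬ i < n := by simpa using hi
      simp [this]
    · exact dif_neg (not_lt.2 hi)
    · refine WithCStarModule.ext fun k => ?_
      change _ = star (((if h : (k.2 : ℕ) < n then _ else 0 : B)) : Unitization ℂ B)
      rw [dif_pos k.2.2, ← Unitization.inr_star, star_star]
      refine Unitization.ext ?_ ?_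
      · rw [h0]; rfl
      · rfl
  have key : ∀ v, ‖CStarMatrix.toCLM X (CStarMatrix.toCLM X v)‖ ≤ c * ‖X‖ * ‖v‖ := fun v => by
    obtain ⟨u, hu, huv⟩ := hrow v
    have h1 := toCLM_rowVec x u
    rw [hx, ← hX, ← huv] at h1
    rw [h1]
    refine (norm_rowVec_le n _).trans ?_
    rw [mul_assoc, hc, Finset.sum_mul]
    refine Finset.sum_le_sum fun i _ => (norm_sum_le _ _).trans ?_
    rw [Finset.sum_mul]
    refine Finset.sum_le_sum fun j _ => (ContinuousLinearMap.le_opNorm _ _).trans ?_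
    refine mul_le_mul_of_nonneg_left ?_ (norm_nonneg _)
    refine (norm_le_norm_rowVec j (hu j)).trans ?_
    rw [← huv]
    exact ContinuousLinearMap.le_opNorm _ _
  have h2 : ‖X‖ * ‖X‖ ≤ c * ‖X‖ := by
    have hsa : star X = X := hx
    rw [← CStarRing.norm_star_mul_self, hsa, CStarMatrix.norm_def]
    refine ContinuousLinearMap.opNorm_le_bound _ (mul_nonneg hc0 (norm_nonneg _)) fun v => ?_
    have h3 : CStarMatrix.toCLM (X * X) v = CStarMatrix.toCLM X (CStarMatrix.toCLM X v) := by
      have := map_mul (CStarMatrix.toCLMNonUnitalAlgHom (n := Fin 2 × Fin n)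
        (A := Unitization ℂ B)) X X
      exact congrArg (fun T => (MulOpposite.unop T) v) this
    rw [h3]
    exact key v
  rcases (norm_nonneg X).eq_or_lt with h | h
  · rw [← h]; exact hc0
  · exact le_of_mul_le_mul_right h2 h

end

/-- Projection matrices over `B̃` that agree modulo `B` and are close as operators on `H_B` are
Murray–von Neumann equivalent. -/
theorem mvN_of_norm_blockOp_lt {n : ℕ}
    {p q : Matrix (Fin 2 × Fin n) (Fin 2 × Fin n) (Unitization ℂ B)}
    (hp : IsStarProjection p) (hq : IsStarProjection q) (hB : ∀ k l, ((p - q) k l).fst = 0)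
    (h : ∀ i j, ‖blockOp (p - q) i j‖ < 1 / 4) : MvN p q := by
  let _ := CStarAlgebra.spectralOrder (Unitization ℂ B)
  have _ := CStarAlgebra.spectralOrderedRing (Unitization ℂ B)
  have hsa : (p - q)ᴴ = p - q := hp.isSelfAdjoint.sub hq.isSelfAdjoint
  have h1 : ‖CStarMatrix.ofMatrix (p - q)‖ < 1 := by
    refine (norm_le_sum_blockOp hsa hB).trans_lt ?_
    rw [Fin.sum_univ_two, Fin.sum_univ_two, Fin.sum_univ_two]
    linarith [h 0 0, h 0 1, h 1 0, h 1 1]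
  have hp' : IsStarProjection (CStarMatrix.ofMatrix p) := ⟨hp.1, hp.2⟩
  have hq' : IsStarProjection (CStarMatrix.ofMatrix q) := ⟨hq.1, hq.2⟩
  obtain ⟨v, h2, h3⟩ := hp'.exists_partialIsometry hq' h1
  exact ⟨CStarMatrix.ofMatrix.symm v, h2, h3⟩

/-- A self-adjoint matrix over `B̃` that is idempotent modulo `B` and almost idempotent as an
operator on `H_B` is close, as an operator on `H_B`, to a projection that agrees with it
modulo `B`. -/
theorem exists_projection_of_norm_blockOp_le {n : ℕ}
    {x : Matrix (Fin 2 × Fin n) (Fin 2 × Fin n) (Unitization ℂ B)} (hx : xᴴ = x)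
    (hB : ∀ k l, ((x * x - x) k l).fst = 0) {ε : ℝ} (hε : ε < 1 / 16)
    (h : ∀ i j, ‖blockOp (x * x - x) i j‖ ≤ ε) :
    ∃ p : Matrix (Fin 2 × Fin n) (Fin 2 × Fin n) (Unitization ℂ B), IsStarProjection p ∧
      (∀ k l, ((p - x) k l).fst = 0) ∧ ∀ i j, ‖blockOp (p - x) i j‖ ≤ 8 * ε := by
  let _ := CStarAlgebra.spectralOrder (Unitization ℂ B)
  have _ := CStarAlgebra.spectralOrderedRing (Unitization ℂ B)
  have hsa : (x * x - x)ᴴ = x * x - x := by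
    rw [Matrix.conjTranspose_sub, Matrix.conjTranspose_mul, hx]
  have h1 : ‖CStarMatrix.ofMatrix (x * x - x)‖ ≤ 4 * ε := by
    refine (norm_le_sum_blockOp hsa hB).trans ?_
    rw [Fin.sum_univ_two, Fin.sum_univ_two, Fin.sum_univ_two]
    linarith [h 0 0, h 0 1, h 1 0, h 1 1]
  have hx' : IsSelfAdjoint (CStarMatrix.ofMatrix x) := hx
  obtain ⟨y, hy, hy2⟩ := hx'.exists_isStarProjection (lt_of_le_of_lt h1 (by linarith))
  set Y : Matrix (Fin 2 × Fin n) (Fin 2 × Fin n) (Unitization ℂ B) :=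
    CStarMatrix.ofMatrix.symm y with hY
  refine ⟨x + (x * x - x) * Y, ⟨hy.1, hy.2⟩, fun k l => ?_, fun i j => ?_⟩
  · rw [add_sub_cancel_left, fst_matrix_mul]
    exact Finset.sum_eq_zero fun m _ => mul_eq_zero_of_left (hB k m) _
  · rw [add_sub_cancel_left]
    refine (norm_blockOp_le _ i j).trans ?_
    change ‖CStarMatrix.ofMatrix (x * x - x) * y‖ ≤ _
    refine (norm_mul_le _ _).trans ?_
    nlinarith [norm_nonneg y, norm_nonneg (CStarMatrix.ofMatrix (x * x - x))]

end KTheory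

/-! ### Classes of projection matrices over arbitrary finite index types -/

namespace KTheory

section

variable {R : Type*} [Ring R] [StarRing R]

/-- The class in `K₀(R)` of a projection matrix indexed by any finite type. -/
noncomputable def projClass {ι : Type*} [Fintype ι] (p : Matrix ι ι R) (hp : IsStarProjection p) :
    K0Unital R :=
  K0Unital.cls ⟨Fintype.card ι, p.submatrix (Fintype.equivFin ι).symm (Fintype.equivFin ι).symm,
    isStarProjection_submatrix hp _⟩

theorem K0Unital.cls_eq_of_mvN {p q : MatProj R} (h : MvN p.mat q.mat) :
    K0Unital.cls p = K0Unital.cls q :=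
  congrArg Algebra.GrothendieckAddGroup.of (Quotient.sound h)

theorem K0Unital.cls_sum (p q : MatProj R) :
    K0Unital.cls (p.sum q) = K0Unital.cls p + K0Unital.cls q :=
  map_add Algebra.GrothendieckAddGroup.of (V.mk p) (V.mk q)

theorem projClass_eq_of_mvN {ι κ : Type*} [Fintype ι] [Fintype κ] {p : Matrix ι ι R}
    {q : Matrix κ κ R} (hp : IsStarProjection p) (hq : IsStarProjection q) (h : MvN p q) :
    projClass p hp = projClass q hq :=
  K0Unital.cls_eq_of_mvN (MvN.trans (isStarProjection_submatrix hp _)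
    (isStarProjection_submatrix hq _) (MvN.submatrix hp _).symm
    (MvN.trans hp (isStarProjection_submatrix hq _) h (MvN.submatrix hq _)))

theorem projClass_fin {n : ℕ} (p : Matrix (Fin n) (Fin n) R) (hp : IsStarProjection p) :
    projClass p hp = K0Unital.cls ⟨n, p, hp⟩ :=
  K0Unital.cls_eq_of_mvN (MvN.submatrix hp _).symm

theorem projClass_submatrix {ι κ : Type*} [Fintype ι] [Fintype κ] {p : Matrix ι ι R}
    (hp : IsStarProjection p) (e : κ ≃ ι) :
    projClass (p.submatrix e e) (isStarProjection_submatrix hp e) = projClass p hp :=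
  projClass_eq_of_mvN _ _ (MvN.submatrix hp e).symm

theorem projClass_blockSum {ι κ : Type*} [Fintype ι] [Fintype κ] {p : Matrix ι ι R}
    {q : Matrix κ κ R} (hp : IsStarProjection p) (hq : IsStarProjection q) :
    projClass (blockSum p q) (isStarProjection_blockSum hp hq) =
      projClass p hp + projClass q hq := by
  rw [projClass, projClass, projClass, ← K0Unital.cls_sum]
  refine K0Unital.cls_eq_of_mvN ?_
  exact MvN.trans (isStarProjection_submatrix (isStarProjection_blockSum hp hq) _)
    (MatProj.isProj _) (MvN.submatrix (isStarProjection_blockSum hp hq) _).symm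
    (MvN.trans (isStarProjection_blockSum hp hq) (MatProj.isProj _)
      (MvN.blockSum (MvN.submatrix hp _) (MvN.submatrix hq _)) (MatProj.sum_mvn _ _))

theorem projClass_add {ι : Type*} [Fintype ι] {p q : Matrix ι ι R}
    (hp : IsStarProjection p) (hq : IsStarProjection q) (hpq : IsStarProjection (p + q))
    (h : p * q = 0) : projClass (p + q) hpq = projClass p hp + projClass q hq := by
  rw [← projClass_blockSum hp hq]
  have hp1 : p * p = p := hp.isIdempotentElem
  have hq1 : q * q = q := hq.isIdempotentElem
  have hp2 : pᴴ = p := hp.isSelfAdjoint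
  have hq2 : qᴴ = q := hq.isSelfAdjoint
  have h' : q * p = 0 := by
    rw [← hp2, ← hq2, ← Matrix.conjTranspose_mul, h, Matrix.conjTranspose_zero]
  refine projClass_eq_of_mvN _ _ (MvN.symm ⟨Matrix.fromCols p q, ?_, ?_⟩)
  · rw [Matrix.conjTranspose_fromCols_eq_fromRows_conjTranspose, Matrix.fromRows_mul_fromCols,
      hp2, hq2, hp1, hq1, h, h']
    rfl
  · rw [Matrix.conjTranspose_fromCols_eq_fromRows_conjTranspose, Matrix.fromCols_mul_fromRows,
      hp2, hq2, hp1, hq1]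

theorem projClass_zero {ι : Type*} [Fintype ι] :
    projClass (0 : Matrix ι ι R) (IsStarProjection.zero _) = 0 := by
  have h := projClass_add (R := R) (ι := ι) (IsStarProjection.zero _) (IsStarProjection.zero _)
    (by rw [add_zero]; exact IsStarProjection.zero _) (zero_mul 0)
  simpa using h

theorem projClass_one_sub {ι : Type*} [Fintype ι] [DecidableEq ι] {p : Matrix ι ι R}
    (hp : IsStarProjection p) :
    projClass (1 - p) hp.one_sub =
      projClass (1 : Matrix ι ι R) (IsStarProjection.one (Matrix ι ι R)) - projClass p hp := by
  have h := projClass_add hp hp.one_sub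
    (by rw [add_sub_cancel]; exact IsStarProjection.one _)
    (by rw [mul_sub, mul_one, hp.isIdempotentElem.eq, sub_self])
  rw [eq_sub_iff_add_eq, add_comm, ← h]
  simp only [add_sub_cancel]

end

end KTheory

/-! ### Block operators -/

namespace KTheory

open HilbertMod

variable {B : Type*} [NonUnitalCStarAlgebra B]

/-- The projection `1 ⊕ 0` in `M₂(M_n(R))`. -/
def cornerUnit (R : Type*) [Ring R] (n : ℕ) : Matrix (Fin 2 × Fin n) (Fin 2 × Fin n) R :=
  Matrix.diagonal fun k => if k.1 = 0 then 1 else 0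

theorem isStarProjection_cornerUnit (R : Type*) [Ring R] [StarRing R] (n : ℕ) :
    IsStarProjection (cornerUnit R n) := by
  constructor
  · change cornerUnit R n * cornerUnit R n = cornerUnit R n
    simp [cornerUnit, Matrix.diagonal_mul_diagonal]
  · change (cornerUnit R n)ᴴ = cornerUnit R n
    rw [cornerUnit, Matrix.diagonal_conjTranspose]
    congr 1
    ext k
    by_cases h : k.1 = 0 <;> simp [h]

theorem blockOp_add {n : ℕ} (x y : Matrix (Fin 2 × Fin n) (Fin 2 × Fin n) (Unitization ℂ B))
    (i j : Fin 2) : blockOp (x + y) i j = blockOp x i j + blockOp y i j := matOp_add _ _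

theorem blockOp_sub {n : ℕ} (x y : Matrix (Fin 2 × Fin n) (Fin 2 × Fin n) (Unitization ℂ B))
    (i j : Fin 2) : blockOp (x - y) i j = blockOp x i j - blockOp y i j := matOp_sub _ _

theorem blockOp_smul {n : ℕ} (c : ℂ)
    (x : Matrix (Fin 2 × Fin n) (Fin 2 × Fin n) (Unitization ℂ B))
    (i j : Fin 2) : blockOp (c • x) i j = c • blockOp x i j := matOp_smul _ _

theorem matOp_zero {n : ℕ} : matOp (0 : Matrix (Fin n) (Fin n) (Unitization ℂ B)) = 0 := by
  rw [← zero_smul ℂ (0 : Matrix (Fin n) (Fin n) (Unitization ℂ B)), matOp_smul, zero_smul]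

theorem matOp_sum {n : ℕ} {ι : Type*} (s : Finset ι)
    (F : ι → Matrix (Fin n) (Fin n) (Unitization ℂ B)) :
    matOp (∑ k ∈ s, F k) = ∑ k ∈ s, matOp (F k) := by
  induction s using Finset.cons_induction with
  | empty => exact matOp_zero
  | cons a s ha ih => rw [Finset.sum_cons, Finset.sum_cons, matOp_add, ih]

theorem blockOp_mul {n : ℕ} (x y : Matrix (Fin 2 × Fin n) (Fin 2 × Fin n) (Unitization ℂ B))
    (i j : Fin 2) : blockOp (x * y) i j = ∑ k, blockOp x i k * blockOp y k j := by
  simp only [blockOp, ← matOp_mul]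
  rw [← matOp_sum]
  congr 1
  ext a b : 1
  simp only [Matrix.of_apply, Matrix.mul_apply, Fintype.sum_prod_type, Matrix.sum_apply]

theorem blockOp_cornerUnit_mul {n : ℕ}
    (x : Matrix (Fin 2 × Fin n) (Fin 2 × Fin n) (Unitization ℂ B)) (i j : Fin 2) :
    blockOp (cornerUnit _ n * x) i j = if i = 0 then blockOp x i j else 0 := by
  simp only [blockOp, cornerUnit, Matrix.diagonal_mul]
  split_ifs
  · simp only [one_mul]
  · simp only [zero_mul]
    exact matOp_zero

theorem blockOp_mul_cornerUnit {n : ℕ}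
    (x : Matrix (Fin 2 × Fin n) (Fin 2 × Fin n) (Unitization ℂ B)) (i j : Fin 2) :
    blockOp (x * cornerUnit _ n) i j = if j = 0 then blockOp x i j else 0 := by
  simp only [blockOp, cornerUnit, Matrix.mul_diagonal]
  split_ifs
  · simp only [mul_one]
  · simp only [mul_zero]
    exact matOp_zero

theorem isAdjointPair_blockOp {n : ℕ}
    (x : Matrix (Fin 2 × Fin n) (Fin 2 × Fin n) (Unitization ℂ B)) (i j : Fin 2) :
    IsAdjointPair (blockOp x i j) (blockOp xᴴ j i) := isAdjointPair_matOp _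

/-- The splitting of `Fin 2 × Fin (n + k)` used to pad block matrices. -/
def padEquiv (n k : ℕ) : Fin 2 × Fin (n + k) ≃ (Fin 2 × Fin n) ⊕ (Fin 2 × Fin k) :=
  ((Equiv.refl _).prodCongr finSumFinEquiv.symm).trans (Equiv.prodSumDistrib _ _ _)

theorem padEquiv_castAdd (n k : ℕ) (i : Fin 2) (a : Fin n) :
    padEquiv n k (i, Fin.castAdd k a) = Sum.inl (i, a) := by
  simp [padEquiv]

theorem padEquiv_natAdd (n k : ℕ) (i : Fin 2) (a : Fin k) :
    padEquiv n k (i, Fin.natAdd n a) = Sum.inr (i, a) := by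
  simp [padEquiv]

theorem cornerUnit_add (R : Type*) [Ring R] (n k : ℕ) : cornerUnit R (n + k) =
    (blockSum (cornerUnit R n) (cornerUnit R k)).submatrix (padEquiv n k) (padEquiv n k) := by
  have h1 : ∀ (a : Fin n) (b : Fin k), Fin.castAdd k a ≠ Fin.natAdd n b := fun a b h => by
    have := congrArg Fin.val h
    simp only [Fin.val_castAdd, Fin.val_natAdd] at this
    omega
  ext ⟨i, a⟩ ⟨j, b⟩
  induction a using Fin.addCases <;> induction b using Fin.addCases <;>
  simp [padEquiv_castAdd, padEquiv_natAdd, blockSum, cornerUnit, Matrix.diagonal_apply,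
    Prod.ext_iff, h1, (h1 _ _).symm]

/-- Padding a block matrix by zeros does not change its blocks as operators on `H_B`. -/
theorem blockOp_pad {n : ℕ} (k : ℕ)
    (d : Matrix (Fin 2 × Fin n) (Fin 2 × Fin n) (Unitization ℂ B)) (i j : Fin 2) :
    blockOp ((blockSum d (0 : Matrix (Fin 2 × Fin k) (Fin 2 × Fin k) _)).submatrix
      (padEquiv n k) (padEquiv n k)) i j = blockOp d i j := by
  refine ContinuousLinearMap.ext fun z => matOp_ext (fun a => ?_)
    fun a ha => matOp_coord_of_le _ _ (by omega)
  rw [Fin.sum_univ_add]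
  induction a using Fin.addCases with
  | left a =>
    have h := inr_matOp_coord (Matrix.of fun a b => d (i, a) (j, b)) z a
    refine Eq.trans ?_ h.symm
    simp [padEquiv_castAdd, padEquiv_natAdd, blockSum]
  | right a =>
    have h := matOp_coord_of_le (Matrix.of fun a b => d (i, a) (j, b)) z
      (i := (Fin.natAdd n a : Fin (n + k))) (by simp)
    rw [blockOp, h]
    simp [padEquiv_castAdd, padEquiv_natAdd, blockSum]

end KTheory

/-! ### Truncation and rank-one operators -/

namespace KTheory

open HilbertMod

variable {B : Type*} [NonUnitalCStarAlgebra B]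

/-- The vector `z` with all coordinates beyond the first `n` replaced by `0`. -/
def trunc (n : ℕ) (z : HMod B) : HMod B :=
  ⟨fun i => if i < n then z.coord i else 0, by
    refine summable_of_ne_finset_zero (s := Finset.range n) fun i hi => ?_
    have : ¬ i < n := by simpa using hi
    simp [this]⟩

theorem trunc_coord (n : ℕ) (z : HMod B) (i : ℕ) :
    (trunc n z).coord i = if i < n then z.coord i else 0 := rfl

theorem tendsto_trunc (z : HMod B) :
    Filter.Tendsto (fun n => trunc n z) Filter.atTop (nhds z) := by
  have h1 : ∀ n, ‖trunc n z - z‖ ^ 2 =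
      ‖z.ip z - ∑ i ∈ Finset.range n, star (z.coord i) * z.coord i‖ := fun n => by
    have h2 : ∑ i ∈ Finset.range n, star (z.coord i) * z.coord i =
        (trunc n z).ip (trunc n z) := by
      rw [HMod.ip, tsum_eq_sum (s := Finset.range n)]
      · refine Finset.sum_congr rfl fun i hi => ?_
        rw [trunc_coord, if_pos (Finset.mem_range.1 hi)]
      · intro i hi
        rw [trunc_coord, if_neg (by simpa using hi), mul_zero]
    have h3 : (trunc n z - z).ip (trunc n z - z) + (trunc n z).ip (trunc n z) = z.ip z := by
      rw [HMod.ip, HMod.ip, HMod.ip,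
        ← (HMod.summable_ip_self _).tsum_add (HMod.summable_ip_self _)]
      refine tsum_congr fun i => ?_
      rw [HMod.coord_sub, trunc_coord]
      split_ifs <;> simp
    rw [HMod.norm_sq, h2, ← h3, add_sub_cancel_right]
  have h2 : Filter.Tendsto (fun n => ‖trunc n z - z‖ ^ 2) Filter.atTop (nhds 0) := by
    simp only [h1]
    have h3 := z.summable_ip_self.hasSum.tendsto_sum_nat
    simpa [HMod.ip] using (h3.const_sub (z.ip z)).norm
  rw [tendsto_iff_norm_sub_tendsto_zero]
  simpa [Real.sqrt_sq (norm_nonneg _)] using h2.sqrt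

theorem tendsto_theta {α : Type*} {l : Filter α} {x y : α → HMod B} {x₀ y₀ : HMod B}
    (hx : Filter.Tendsto x l (nhds x₀)) (hy : Filter.Tendsto y l (nhds y₀)) :
    Filter.Tendsto (fun t => theta (x t) (y t)) l (nhds (theta x₀ y₀)) := by
  rw [tendsto_iff_norm_sub_tendsto_zero] at hx hy ⊢
  have h : Filter.Tendsto (fun t => ‖x t - x₀‖ * ‖y t - y₀‖ + ‖x t - x₀‖ * ‖y₀‖ +
      ‖x₀‖ * ‖y t - y₀‖) l (nhds 0) := by
    simpa using ((hx.mul hy).add (hx.mul_const ‖y₀‖)).add (hy.const_mul ‖x₀‖)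
  refine squeeze_zero (fun t => norm_nonneg _) (fun t => ?_) h
  have h1 : theta (x t) (y t) - theta x₀ y₀ =
      theta (x t - x₀) (y t - y₀) + theta (x t - x₀) y₀ + theta x₀ (y t - y₀) := by
    simp only [theta_sub_left, theta_sub_right]
    abel
  rw [h1]
  exact (norm_add₃_le).trans (add_le_add (add_le_add (norm_theta_le _ _) (norm_theta_le _ _))
    (norm_theta_le _ _))

/-- The matrix `(xₐ y_b*)` acts as the truncation of the rank-one operator `θ_{x, y}`. -/
theorem matOp_theta (n : ℕ) (x y : HMod B) :
    matOp (Matrix.of fun a b : Fin n =>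
      ((x.coord a * star (y.coord b) : B) : Unitization ℂ B)) =
      theta (trunc n x) (trunc n y) := by
  refine ContinuousLinearMap.ext fun z => matOp_ext (fun a => ?_) fun a ha => ?_
  · rw [theta_apply, HMod.coord_rmul, trunc_coord, if_pos a.2, HMod.ip,
      tsum_eq_sum (s := Finset.range n), Finset.sum_range, Unitization.inr_mul]
    · rw [inr_sum, Finset.mul_sum]
      refine Finset.sum_congr rfl fun b _ => ?_
      rw [trunc_coord, if_pos b.2, Matrix.of_apply, ← Unitization.inr_mul, ← Unitization.inr_mul,
        mul_assoc]
    · intro b hb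
      rw [trunc_coord, if_neg (by simpa using hb), star_zero, zero_mul]
  · rw [theta_apply, HMod.coord_rmul, trunc_coord, if_neg (not_lt.2 ha), zero_mul]

end KTheory

/-! ### The blocks of a Cuntz pair -/

namespace KTheory

open HilbertMod

variable {B : Type*} [NonUnitalCStarAlgebra B]

/-- `φ(1)` for a Cuntz pair `(φ, ψ)`, as a bounded operator. -/
noncomputable def CuntzPair.leftOp (a : CuntzPair B) : Op B := a.isProj_left.toOp

/-- `ψ(1)` for a Cuntz pair `(φ, ψ)`, as a bounded operator. -/
noncomputable def CuntzPair.rightOp (a : CuntzPair B) : Op B := a.isProj_right.toOp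

/-- The difference of the two projections of a Cuntz pair. -/
noncomputable def CuntzPair.diffOp (a : CuntzPair B) : Op B := a.leftOp - a.rightOp

/-- The pair `(Q, 1 - Q)`, for the second projection `Q` of a Cuntz pair. -/
noncomputable def CuntzPair.split (a : CuntzPair B) : Fin 2 → Op B := ![a.rightOp, 1 - a.rightOp]

/-- For a Cuntz pair `(P, Q)`, the blocks of `w (P ⊕ (1 - Q)) w - (1 ⊕ 0)`, where `w` is the
self-adjoint unitary with rows `(Q, 1 - Q)` and `(1 - Q, Q)`. Equivalently, these are the blocks of
`w ((P - Q) ⊕ 0) w`. -/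
noncomputable def CuntzPair.blk (a : CuntzPair B) (i j : Fin 2) : Op B :=
  a.split i * a.diffOp * a.split j

theorem isAdjointPair_diffOp (a : CuntzPair B) : IsAdjointPair a.diffOp a.diffOp :=
  a.isProj_left.isAdjointPair.sub a.isProj_right.isAdjointPair

theorem isAdjointPair_split (a : CuntzPair B) (i : Fin 2) :
    IsAdjointPair (a.split i) (a.split i) := by
  fin_cases i
  · exact a.isProj_right.isAdjointPair
  · exact IsAdjointPair.one.sub a.isProj_right.isAdjointPair

theorem isAdjointPair_blk (a : CuntzPair B) (i j : Fin 2) :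
    IsAdjointPair (a.blk i j) (a.blk j i) := by
  have h := ((isAdjointPair_split a i).mul (isAdjointPair_diffOp a)).mul (isAdjointPair_split a j)
  rwa [← mul_assoc] at h

theorem norm_split_le (a : CuntzPair B) (i : Fin 2) : ‖a.split i‖ ≤ 2 := by
  have h1 : ‖a.rightOp‖ ≤ 1 := a.isProj_right.norm_toOp_le
  have h2 : ‖(1 : Op B)‖ ≤ 1 := ContinuousLinearMap.norm_id_le
  fin_cases i
  · exact h1.trans one_le_two
  · exact (norm_sub_le _ _).trans (by linarith)

theorem norm_diffOp_le (a : CuntzPair B) : ‖a.diffOp‖ ≤ 2 := by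
  have h1 : ‖a.rightOp‖ ≤ 1 := a.isProj_right.norm_toOp_le
  have h2 : ‖a.leftOp‖ ≤ 1 := a.isProj_left.norm_toOp_le
  exact (norm_sub_le _ _).trans (by linarith)

theorem norm_blk_le (a : CuntzPair B) (i j : Fin 2) : ‖a.blk i j‖ ≤ 8 := by
  have h := norm_split_le a i
  have h' := norm_split_le a j
  have hd := norm_diffOp_le a
  calc ‖a.blk i j‖ ≤ ‖a.split i‖ * ‖a.diffOp‖ * ‖a.split j‖ :=
        (norm_mul_le _ _).trans (mul_le_mul_of_nonneg_right (norm_mul_le _ _) (norm_nonneg _))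
    _ ≤ 2 * 2 * 2 := by gcongr
    _ = 8 := by norm_num

/-- The blockwise form of `e² - e`, for `e = (1 ⊕ 0) + M`. -/
def defect {R : Type*} [Ring R] (M : Fin 2 → Fin 2 → R) (i j : Fin 2) : R :=
  (if i = 0 then M i j else 0) + (if j = 0 then M i j else 0) + ∑ k, M i k * M k j - M i j

/-- `(1 ⊕ 0) + blk` is idempotent. -/
theorem defect_blk (a : CuntzPair B) (i j : Fin 2) : defect a.blk i j = 0 := by
  have hP : a.leftOp * a.leftOp = a.leftOp := a.isProj_left.toOp_mul_self
  have hQ : a.rightOp * a.rightOp = a.rightOp := a.isProj_right.toOp_mul_self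
  have hP' : ∀ x, a.leftOp * (a.leftOp * x) = a.leftOp * x := fun x => by rw [← mul_assoc, hP]
  have hQ' : ∀ x, a.rightOp * (a.rightOp * x) = a.rightOp * x := fun x => by rw [← mul_assoc, hQ]
  fin_cases i <;> fin_cases j <;>
  · simp only [defect, CuntzPair.blk, CuntzPair.split, CuntzPair.diffOp, Fin.sum_univ_two]
    simp
    noncomm_ring
    simp only [hP, hQ, hP', hQ']
    abel

/-- `defect` computes the blocks of `e² - e` for `e = (1 ⊕ 0) + m`. -/
theorem blockOp_defect {n : ℕ}
    (m : Matrix (Fin 2 × Fin n) (Fin 2 × Fin n) (Unitization ℂ B)) (i j : Fin 2) :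
    blockOp ((cornerUnit _ n + m) * (cornerUnit _ n + m) - (cornerUnit _ n + m)) i j =
      defect (blockOp m) i j := by
  have h : (cornerUnit _ n + m) * (cornerUnit _ n + m) - (cornerUnit _ n + m) =
      cornerUnit _ n * m + m * cornerUnit _ n + m * m - m := by
    have hs : cornerUnit (Unitization ℂ B) n * cornerUnit _ n = cornerUnit _ n :=
      (isStarProjection_cornerUnit _ n).isIdempotentElem
    rw [add_mul, mul_add, mul_add, hs]
    abel
  rw [h, blockOp_sub, blockOp_add, blockOp_add, blockOp_cornerUnit_mul, blockOp_mul_cornerUnit,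
    blockOp_mul, defect]

/-- `defect` is stable under small perturbations: if it vanishes at `C`, it is small near `C`. -/
theorem norm_defect_le {R : Type*} [NormedRing R] {M C : Fin 2 → Fin 2 → R} {η : ℝ}
    (hη : η ≤ 1) (hC : ∀ i j, ‖C i j‖ ≤ 8) (hM : ∀ i j, ‖M i j - C i j‖ ≤ η)
    (h0 : ∀ i j, defect C i j = 0) (i j : Fin 2) : ‖defect M i j‖ ≤ 37 * η := by
  have hite : ∀ (c : Prop) [Decidable c] (x y : R), ‖x - y‖ ≤ η →
      ‖(if c then x else 0) - (if c then y else 0)‖ ≤ η := fun c _ x y h => by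
    split_ifs
    · exact h
    · rw [sub_zero, norm_zero]; exact (norm_nonneg _).trans h
  have hprod : ∀ k, ‖M i k * M k j - C i k * C k j‖ ≤ 17 * η := fun k => by
    have h1 : M i k * M k j - C i k * C k j =
        (M i k - C i k) * (M k j - C k j) + (M i k - C i k) * C k j +
          C i k * (M k j - C k j) := by noncomm_ring
    have hη0 : 0 ≤ η := (norm_nonneg _).trans (hM i j)
    have b1 : ‖(M i k - C i k) * (M k j - C k j)‖ ≤ η * 1 :=
      (norm_mul_le _ _).trans (mul_le_mul (hM _ _) ((hM _ _).trans hη) (norm_nonneg _) hη0)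
    have b2 : ‖(M i k - C i k) * C k j‖ ≤ η * 8 :=
      (norm_mul_le _ _).trans (mul_le_mul (hM _ _) (hC _ _) (norm_nonneg _) hη0)
    have b3 : ‖C i k * (M k j - C k j)‖ ≤ 8 * η :=
      (norm_mul_le _ _).trans (mul_le_mul (hC _ _) (hM _ _) (norm_nonneg _) (by norm_num))
    rw [h1]
    exact norm_add₃_le.trans (by linarith)
  have h1 : defect M i j = ((if i = 0 then M i j else 0) - (if i = 0 then C i j else 0)) +
      ((if j = 0 then M i j else 0) - (if j = 0 then C i j else 0)) +
      ((M i 0 * M 0 j - C i 0 * C 0 j) + (M i 1 * M 1 j - C i 1 * C 1 j)) - (M i j - C i j) := by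
    calc defect M i j = defect M i j - defect C i j := by rw [h0 i j, sub_zero]
      _ = _ := by simp only [defect, Fin.sum_univ_two]; abel
  rw [h1]
  have e1 := hite (i = 0) _ _ (hM i j)
  have e2 := hite (j = 0) _ _ (hM i j)
  refine (norm_sub_le _ _).trans ?_
  have e3 := norm_add₃_le (a := (if i = 0 then M i j else 0) - (if i = 0 then C i j else 0))
    (b := (if j = 0 then M i j else 0) - (if j = 0 then C i j else 0))
    (c := (M i 0 * M 0 j - C i 0 * C 0 j) + (M i 1 * M 1 j - C i 1 * C 1 j))
  have e4 := norm_add_le (M i 0 * M 0 j - C i 0 * C 0 j) (M i 1 * M 1 j - C i 1 * C 1 j)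
  linarith [hprod 0, hprod 1, hM i j]

end KTheory

/-! ### The invariant of a Cuntz pair -/

namespace KTheory

open HilbertMod

variable {B : Type*} [NonUnitalCStarAlgebra B]

theorem CuntzPair.exists_finiteRank (a : CuntzPair B) {ε : ℝ} (hε : 0 < ε) :
    ∃ (m : ℕ) (x y : Fin m → HMod B), ‖a.diffOp - ∑ k, theta (x k) (y k)‖ ≤ ε := by
  obtain ⟨m, x, y, h⟩ := a.isCompact_sub ε hε
  refine ⟨m, x, y, ContinuousLinearMap.opNorm_le_bound _ hε.le fun z => ?_⟩
  have h1 : (a.diffOp - ∑ k, theta (x k) (y k)) z =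
      (a.left z - a.right z) - finiteRank x y z := by
    rw [Op.sub_apply, sum_apply]
    rfl
  rw [h1]
  exact h z

/-- The blocks of a Cuntz pair are approximated by a self-adjoint block matrix over `B`. -/
theorem CuntzPair.exists_matrix (a : CuntzPair B) {η : ℝ} (hη : 0 < η) :
    ∃ (n : ℕ) (m : Matrix (Fin 2 × Fin n) (Fin 2 × Fin n) (Unitization ℂ B)), mᴴ = m ∧
      (∀ k l, (m k l).fst = 0) ∧ ∀ i j, ‖blockOp m i j - a.blk i j‖ ≤ η := by
  obtain ⟨r, x, y, hD⟩ := a.exists_finiteRank (ε := η / 8) (by positivity)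
  have hF : ∀ i j, a.split i * (∑ k, theta (x k) (y k)) * a.split j =
      ∑ k, theta (a.split i (x k)) (a.split j (y k)) := fun i j => by
    rw [Finset.mul_sum, Finset.sum_mul]
    refine Finset.sum_congr rfl fun k _ => ?_
    rw [(isAdjointPair_split a i).mul_theta, (isAdjointPair_split a j).theta_mul]
  have hlim : ∀ᶠ n in Filter.atTop, ∀ i j, ‖(∑ k, theta (trunc n (a.split i (x k)))
      (trunc n (a.split j (y k)))) - ∑ k, theta (a.split i (x k)) (a.split j (y k))‖ < η / 2 := by
    rw [Filter.eventually_all]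
    intro i
    rw [Filter.eventually_all]
    intro j
    have h : Filter.Tendsto (fun n => ∑ k, theta (trunc n (a.split i (x k)))
        (trunc n (a.split j (y k)))) Filter.atTop
        (nhds (∑ k, theta (a.split i (x k)) (a.split j (y k)))) :=
      tendsto_finsetSum _ fun k _ => tendsto_theta (tendsto_trunc _) (tendsto_trunc _)
    exact (tendsto_iff_norm_sub_tendsto_zero.1 h).eventually (gt_mem_nhds (by positivity))
  obtain ⟨n, hn⟩ := hlim.exists
  set m : Matrix (Fin 2 × Fin n) (Fin 2 × Fin n) (Unitization ℂ B) :=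
    Matrix.of fun k l => ∑ s, (((a.split k.1 (x s)).coord k.2 *
      star ((a.split l.1 (y s)).coord l.2) : B) : Unitization ℂ B) with hm
  have hmB : ∀ k l, (m k l).fst = 0 := fun k l => by
    rw [hm, Matrix.of_apply, fst_sum]
    exact Finset.sum_eq_zero fun s _ => Unitization.fst_inr ℂ ((a.split k.1 (x s)).coord k.2 *
      star ((a.split l.1 (y s)).coord l.2))
  have hmop : ∀ i j, blockOp m i j =
      ∑ k, theta (trunc n (a.split i (x k))) (trunc n (a.split j (y k))) := fun i j => by
    simp only [← matOp_theta]
    rw [← matOp_sum, blockOp]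
    congr 1
    ext b c : 1
    simp only [hm, Matrix.of_apply, Matrix.sum_apply]
  have hm1 : ∀ i j, ‖blockOp m i j - a.blk i j‖ ≤ η := fun i j => by
    have h1 : blockOp m i j - a.blk i j = (blockOp m i j -
        ∑ k, theta (a.split i (x k)) (a.split j (y k))) -
        a.split i * (a.diffOp - ∑ k, theta (x k) (y k)) * a.split j := by
      rw [mul_sub, sub_mul, hF, CuntzPair.blk]
      abel
    have h2 : ‖a.split i * (a.diffOp - ∑ k, theta (x k) (y k)) * a.split j‖ ≤ 2 * (η / 8) * 2 := by
      refine (norm_mul_le _ _).trans ?_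
      refine mul_le_mul ((norm_mul_le _ _).trans ?_) (norm_split_le a j) (norm_nonneg _)
        (by positivity)
      exact mul_le_mul (norm_split_le a i) hD (norm_nonneg _) zero_le_two
    have h3 := (hn i j).le
    rw [← hmop] at h3
    rw [h1]
    exact (norm_sub_le _ _).trans (by linarith)
  have hm2 : ∀ i j, ‖blockOp mᴴ i j - a.blk i j‖ ≤ η := fun i j =>
    (((isAdjointPair_blockOp m j i).sub (isAdjointPair_blk a j i)).norm_le).trans (hm1 j i)
  -- the self-adjoint part of `m` is as good an approximation, the blocks being self-adjoint
  refine ⟨n, (1 / 2 : ℂ) • (m + mᴴ), ?_, fun k l => ?_, fun i j => ?_⟩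
  · rw [Matrix.conjTranspose_smul, Matrix.conjTranspose_add, Matrix.conjTranspose_conjTranspose,
      add_comm]
    simp
  · simp [hmB]
  · have h1 : blockOp ((1 / 2 : ℂ) • (m + mᴴ)) i j - a.blk i j =
        (1 / 2 : ℂ) • ((blockOp m i j - a.blk i j) + (blockOp mᴴ i j - a.blk i j)) := by
      rw [blockOp_smul, blockOp_add]
      module
    rw [h1, norm_smul]
    have h2 := norm_add_le (blockOp m i j - a.blk i j) (blockOp mᴴ i j - a.blk i j)
    have h3 : ‖(1 / 2 : ℂ)‖ = 1 / 2 := by norm_num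
    rw [h3]
    linarith [hm1 i j, hm2 i j]

/-- `g ∈ K₀(B̃)` is an index of the Cuntz pair `a`: it is `[p] - [1 ⊕ 0]` for a projection
`p ∈ M₂(M_n(B̃))` with `p - (1 ⊕ 0)` over `B` and close to the blocks of `a` as an operator. -/
def CuntzPair.IsIndex (a : CuntzPair B) (g : K0Unital (Unitization ℂ B)) : Prop :=
  ∃ (n : ℕ) (p : Matrix (Fin 2 × Fin n) (Fin 2 × Fin n) (Unitization ℂ B))
    (hp : IsStarProjection p), (∀ k l, ((p - cornerUnit (Unitization ℂ B) n) k l).fst = 0) ∧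
    (∀ i j, ‖blockOp (p - cornerUnit (Unitization ℂ B) n) i j - a.blk i j‖ < 1 / 8) ∧
    g = projClass p hp - projClass (cornerUnit _ n) (isStarProjection_cornerUnit _ n)

theorem CuntzPair.exists_isIndex (a : CuntzPair B) : ∃ g, a.IsIndex g := by
  -- with `η = 1/4000`, the final error `8 * 37 * η + η` is below the bound `1/8` of `IsIndex`
  obtain ⟨n, m, hm, hmB, hmC⟩ := a.exists_matrix (η := 1 / 4000) (by norm_num)
  have hs : (cornerUnit (Unitization ℂ B) n)ᴴ = cornerUnit _ n :=
    (isStarProjection_cornerUnit (Unitization ℂ B) n).isSelfAdjoint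
  have hdef : ∀ i j, ‖blockOp ((cornerUnit _ n + m) * (cornerUnit _ n + m) -
      (cornerUnit _ n + m)) i j‖ ≤ 37 * (1 / 4000) := fun i j => by
    rw [blockOp_defect]
    exact norm_defect_le (by norm_num) (norm_blk_le a) hmC (defect_blk a) i j
  have hdefB : ∀ k l, (((cornerUnit (Unitization ℂ B) n + m) *
      (cornerUnit (Unitization ℂ B) n + m) -
      (cornerUnit (Unitization ℂ B) n + m)) k l).fst = 0 := fun k l => by
    have h : (cornerUnit _ n + m) * (cornerUnit _ n + m) - (cornerUnit _ n + m) =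
        cornerUnit _ n * m + m * (cornerUnit _ n + m) - m := by
      have hs' : cornerUnit (Unitization ℂ B) n * cornerUnit _ n = cornerUnit _ n :=
        (isStarProjection_cornerUnit _ n).isIdempotentElem
      rw [add_mul, mul_add, hs']
      abel
    rw [h, Matrix.sub_apply, Matrix.add_apply, fst_sub, Unitization.fst_add,
      fst_matrix_mul, fst_matrix_mul]
    simp [hmB]
  obtain ⟨p, hp, hpB, hpC⟩ := exists_projection_of_norm_blockOp_le
    (x := cornerUnit _ n + m) (by rw [Matrix.conjTranspose_add, hs, hm]) hdefB
    (ε := 37 * (1 / 4000)) (by norm_num) hdef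
  refine ⟨projClass p hp - projClass (cornerUnit _ n) (isStarProjection_cornerUnit _ n), n, p, hp,
    fun k l => ?_, fun i j => ?_, rfl⟩
  · have h1 : p - cornerUnit _ n = (p - (cornerUnit _ n + m)) + m := by abel
    rw [h1, Matrix.add_apply, Unitization.fst_add, hpB, hmB, add_zero]
  · have h1 : p - cornerUnit _ n = (p - (cornerUnit _ n + m)) + m := by abel
    have h2 : blockOp (p - cornerUnit _ n) i j - a.blk i j =
        blockOp (p - (cornerUnit _ n + m)) i j + (blockOp m i j - a.blk i j) := by
      rw [h1, blockOp_add]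
      abel
    rw [h2]
    refine (norm_add_le _ _).trans_lt ?_
    linarith [hpC i j, hmC i j]
/-- An index projection of size `n` can be replaced by one of any larger size, padding by
`1 ⊕ 0`. -/
theorem exists_pad_projection {n : ℕ}
    {p : Matrix (Fin 2 × Fin n) (Fin 2 × Fin n) (Unitization ℂ B)} (hp : IsStarProjection p)
    (hB : ∀ k l, ((p - cornerUnit (Unitization ℂ B) n) k l).fst = 0) {N : ℕ} (hN : n ≤ N) :
    ∃ (q : Matrix (Fin 2 × Fin N) (Fin 2 × Fin N) (Unitization ℂ B)) (hq : IsStarProjection q),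
      (∀ k l, ((q - cornerUnit (Unitization ℂ B) N) k l).fst = 0) ∧
      (∀ i j, blockOp (q - cornerUnit (Unitization ℂ B) N) i j =
        blockOp (p - cornerUnit (Unitization ℂ B) n) i j) ∧
      projClass q hq - projClass (cornerUnit _ N) (isStarProjection_cornerUnit _ N) =
        projClass p hp - projClass (cornerUnit _ n) (isStarProjection_cornerUnit _ n) := by
  obtain ⟨k, rfl⟩ := Nat.exists_eq_add_of_le hN
  have hk := isStarProjection_cornerUnit (Unitization ℂ B) k
  have hn := isStarProjection_cornerUnit (Unitization ℂ B) n
  have hsub : (blockSum p (cornerUnit _ k)).submatrix (padEquiv n k) (padEquiv n k) -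
      cornerUnit (Unitization ℂ B) (n + k) =
      (blockSum (p - cornerUnit _ n) (0 : Matrix (Fin 2 × Fin k) (Fin 2 × Fin k) _)).submatrix
        (padEquiv n k) (padEquiv n k) := by
    rw [cornerUnit_add]
    refine Matrix.ext fun x y => ?_
    simp only [Matrix.sub_apply, Matrix.submatrix_apply]
    rcases padEquiv n k x with x | x <;> rcases padEquiv n k y with y | y <;> simp [blockSum]
  refine ⟨_, isStarProjection_submatrix (isStarProjection_blockSum hp hk) (padEquiv n k),
    fun x y => ?_, fun i j => ?_, ?_⟩
  · rw [hsub, Matrix.submatrix_apply]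
    rcases padEquiv n k x with x | x <;> rcases padEquiv n k y with y | y
    · exact hB x y
    all_goals rfl
  · rw [hsub, blockOp_pad]
  · have h1 : projClass (cornerUnit (Unitization ℂ B) (n + k))
        (isStarProjection_cornerUnit _ (n + k)) =
        projClass (cornerUnit _ n) hn + projClass (cornerUnit _ k) hk := by
      rw [← projClass_blockSum, ← projClass_submatrix _ (padEquiv n k)]
      congr 1
      exact cornerUnit_add _ n k
    rw [h1, projClass_submatrix (isStarProjection_blockSum hp hk), projClass_blockSum hp hk]
    abel

/-- Two index projections of a Cuntz pair have, once padded to the same size, blocks within `1/4` of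
each other, so that they are Murray–von Neumann equivalent. -/
theorem CuntzPair.IsIndex.unique {a : CuntzPair B} {g g' : K0Unital (Unitization ℂ B)}
    (h : a.IsIndex g) (h' : a.IsIndex g') : g = g' := by
  obtain ⟨n, p, hp, hpB, hpC, rfl⟩ := h
  obtain ⟨n', p', hp', hpB', hpC', rfl⟩ := h'
  obtain ⟨q, hq, hqB, hqC, h1⟩ := exists_pad_projection hp hpB (le_max_left n n')
  obtain ⟨q', hq', hqB', hqC', h1'⟩ := exists_pad_projection hp' hpB' (le_max_right n n')
  rw [← h1, ← h1', projClass_eq_of_mvN hq hq']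
  have hsub : q - q' = (q - cornerUnit _ _) - (q' - cornerUnit _ _) := by abel
  refine mvN_of_norm_blockOp_lt hq hq' (fun k l => ?_) fun i j => ?_
  · rw [hsub, Matrix.sub_apply, fst_sub, hqB, hqB', sub_zero]
  · have h2 : blockOp (q - q') i j =
        (blockOp (p - cornerUnit _ n) i j - a.blk i j) -
          (blockOp (p' - cornerUnit _ n') i j - a.blk i j) := by
      rw [hsub, blockOp_sub, hqC, hqC']
      abel
    rw [h2]
    exact (norm_sub_le _ _).trans_lt (by linarith [hpC i j, hpC' i j])

/-- The index `K₀`-class of a Cuntz pair, i.e. the class `[w (P ⊕ (1 - Q)) w] - [1 ⊕ 0]`. -/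
noncomputable def CuntzPair.index (a : CuntzPair B) : K0Unital (Unitization ℂ B) :=
  a.exists_isIndex.choose

theorem CuntzPair.isIndex_index (a : CuntzPair B) : a.IsIndex a.index :=
  a.exists_isIndex.choose_spec

/-- The blocks of a Cuntz pair depend continuously, in norm, on the parameter of a homotopy:
multiplication by a compact operator turns strong convergence into norm convergence. -/
theorem tendsto_blk {γ : unitInterval → CuntzPair B} {t₀ : unitInterval}
    (hright : ∀ z, Filter.Tendsto (fun t => ‖(γ t).right z - (γ t₀).right z‖) (nhds t₀) (nhds 0))
    (hdiff : ∀ ε > 0, ∀ᶠ t in nhds t₀, OpNormLE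
      (fun z => ((γ t).left z - (γ t).right z) - ((γ t₀).left z - (γ t₀).right z)) ε)
    (i j : Fin 2) :
    Filter.Tendsto (fun t => (γ t).blk i j) (nhds t₀) (nhds ((γ t₀).blk i j)) := by
  have hD : Filter.Tendsto (fun t => ‖(γ t).diffOp - (γ t₀).diffOp‖) (nhds t₀) (nhds 0) := by
    rw [Metric.tendsto_nhds]
    intro ε hε
    filter_upwards [hdiff (ε / 2) (by positivity)] with t ht
    have h : ‖(γ t).diffOp - (γ t₀).diffOp‖ ≤ ε / 2 :=
      ContinuousLinearMap.opNorm_le_bound _ (by positivity) ht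
    rw [dist_zero_right, norm_norm]
    linarith
  have hsplit : ∀ i z, Filter.Tendsto (fun t => ‖((γ t).split i - (γ t₀).split i) z‖)
      (nhds t₀) (nhds 0) := fun i z => by
    fin_cases i
    · exact hright z
    · refine (hright z).congr fun t => ?_
      rw [← norm_neg]
      congr 1
      change -((γ t).right z - (γ t₀).right z) = (z - (γ t).right z) - (z - (γ t₀).right z)
      abel
  have hcomp : ∀ i, Filter.Tendsto (fun t => ‖((γ t).split i - (γ t₀).split i) * (γ t₀).diffOp‖)
      (nhds t₀) (nhds 0) := fun i => by
    rw [Metric.tendsto_nhds]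
    intro ε hε
    obtain ⟨r, x, y, hF⟩ := (γ t₀).exists_finiteRank (ε := ε / 8) (by positivity)
    have h1 : Filter.Tendsto (fun t => ∑ k, ‖((γ t).split i - (γ t₀).split i) (x k)‖ * ‖y k‖)
        (nhds t₀) (nhds 0) := by
      have := tendsto_finsetSum (Finset.univ : Finset (Fin r)) fun k _ =>
        (hsplit i (x k)).mul_const ‖y k‖
      simpa using this
    filter_upwards [h1.eventually (gt_mem_nhds (half_pos hε))] with t ht
    rw [dist_zero_right, norm_norm]
    set T := (γ t).split i - (γ t₀).split i with hT
    have hTadj : IsAdjointPair T T :=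
      (isAdjointPair_split (γ t) i).sub (isAdjointPair_split (γ t₀) i)
    have hT4 : ‖T‖ ≤ 4 :=
      (norm_sub_le _ _).trans (by linarith [norm_split_le (γ t) i, norm_split_le (γ t₀) i])
    have h2 : T * (γ t₀).diffOp =
        T * ((γ t₀).diffOp - ∑ k, theta (x k) (y k)) + ∑ k, theta (T (x k)) (y k) := by
      rw [mul_sub, Finset.mul_sum]
      simp only [hTadj.mul_theta]
      abel
    have h3 : ‖T * ((γ t₀).diffOp - ∑ k, theta (x k) (y k))‖ ≤ 4 * (ε / 8) :=
      (norm_mul_le _ _).trans (mul_le_mul hT4 hF (norm_nonneg _) (by norm_num))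
    have h4 : ‖∑ k, theta (T (x k)) (y k)‖ ≤ ∑ k, ‖T (x k)‖ * ‖y k‖ :=
      (norm_sum_le _ _).trans (Finset.sum_le_sum fun k _ => norm_theta_le _ _)
    rw [h2]
    exact (norm_add_le _ _).trans_lt (by linarith)
  rw [tendsto_iff_norm_sub_tendsto_zero]
  have hlim : Filter.Tendsto (fun t => 4 * ‖(γ t).diffOp - (γ t₀).diffOp‖ +
      2 * ‖((γ t).split i - (γ t₀).split i) * (γ t₀).diffOp‖ +
      2 * ‖((γ t).split j - (γ t₀).split j) * (γ t₀).diffOp‖) (nhds t₀) (nhds 0) := by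
    simpa using ((hD.const_mul 4).add ((hcomp i).const_mul 2)).add ((hcomp j).const_mul 2)
  refine squeeze_zero (fun t => norm_nonneg _) (fun t => ?_) hlim
  have h1 : (γ t).blk i j - (γ t₀).blk i j =
      (γ t).split i * ((γ t).diffOp - (γ t₀).diffOp) * (γ t).split j +
      ((γ t).split i - (γ t₀).split i) * (γ t₀).diffOp * (γ t).split j +
      (γ t₀).split i * ((γ t₀).diffOp * ((γ t).split j - (γ t₀).split j)) := by
    rw [CuntzPair.blk, CuntzPair.blk]
    noncomm_ring
  have h2 : ‖(γ t₀).diffOp * ((γ t).split j - (γ t₀).split j)‖ ≤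
      ‖((γ t).split j - (γ t₀).split j) * (γ t₀).diffOp‖ :=
    (((isAdjointPair_split (γ t) j).sub (isAdjointPair_split (γ t₀) j)).mul
      (isAdjointPair_diffOp (γ t₀))).norm_le
  have e1 := norm_split_le (γ t) i
  have e2 := norm_split_le (γ t) j
  have e3 := norm_split_le (γ t₀) i
  rw [h1]
  refine norm_add₃_le.trans (add_le_add (add_le_add ?_ ?_) ?_)
  · refine (norm_mul_le _ _).trans ?_
    refine (mul_le_mul ((norm_mul_le _ _).trans (mul_le_mul_of_nonneg_right e1 (norm_nonneg _))) e2
      (norm_nonneg _) (by positivity)).trans (le_of_eq (by ring))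
  · refine (norm_mul_le _ _).trans ?_
    rw [mul_comm]
    exact mul_le_mul_of_nonneg_right e2 (norm_nonneg _)
  · exact (norm_mul_le _ _).trans (mul_le_mul e3 h2 (norm_nonneg _) zero_le_two)

/-- The index is locally constant along a homotopy, because `IsIndex` is an open condition. -/
theorem CuntzPair.Homotopic.index_eq {a b : CuntzPair B} (h : a.Homotopic b) :
    a.index = b.index := by
  obtain ⟨γ, h0, h1, -, hright, hdiff⟩ := h
  have hloc : IsLocallyConstant fun t => (γ t).index := by
    rw [IsLocallyConstant.iff_eventually_eq]
    intro t₀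
    obtain ⟨n, p, hp, hpB, hpC, hg⟩ := (γ t₀).isIndex_index
    have hev : ∀ᶠ t in nhds t₀, ∀ i j,
        ‖blockOp (p - cornerUnit _ n) i j - (γ t).blk i j‖ < 1 / 8 := by
      rw [Filter.eventually_all]
      intro i
      rw [Filter.eventually_all]
      intro j
      have := (tendsto_blk (fun z => hright z t₀) (hdiff t₀) i j).const_sub
        (blockOp (p - cornerUnit _ n) i j)
      exact this.norm.eventually (gt_mem_nhds (hpC i j))
    filter_upwards [hev] with t ht
    exact (γ t).isIndex_index.unique ⟨n, p, hp, hpB, ht, hg⟩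
  rw [← h0, ← h1]
  exact hloc.apply_eq_of_preconnectedSpace 0 1

/-- Equal classes in `KK_h(ℂ, B)` have equal index. -/
theorem CuntzPair.index_eq_of_mk_eq {a b : CuntzPair B} (h : KKh.mk a = KKh.mk b) :
    a.index = b.index :=
  congrArg (Quot.lift CuntzPair.index fun _ _ h => CuntzPair.Homotopic.index_eq h) h

end KTheory

/-! ### The index of a Cuntz pair of matrix projections -/

namespace KTheory

open HilbertMod

section

variable {R : Type*} [Ring R] {n : ℕ}

/-- The self-adjoint unitary in `M₂(M_n(R))` with rows `(f, 1 - f)` and `(1 - f, f)`. -/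
def swapUnitary (f : Matrix (Fin n) (Fin n) R) :
    Matrix (Fin 2) (Fin 2) (Matrix (Fin n) (Fin n) R) :=
  !![f, 1 - f; 1 - f, f]

theorem comp_mul (x y : Matrix (Fin 2) (Fin 2) (Matrix (Fin n) (Fin n) R)) :
    Matrix.comp _ _ _ _ R (x * y) = Matrix.comp _ _ _ _ R x * Matrix.comp _ _ _ _ R y :=
  map_mul (Matrix.compRingEquiv (Fin 2) (Fin n) R) x y

theorem comp_sub (x y : Matrix (Fin 2) (Fin 2) (Matrix (Fin n) (Fin n) R)) :
    Matrix.comp _ _ _ _ R (x - y) = Matrix.comp _ _ _ _ R x - Matrix.comp _ _ _ _ R y := rfl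

/-- The block diagonal matrix with diagonal blocks `e` and `g`, indexed by `Fin 2 × Fin n`. -/
def diagPair (e g : Matrix (Fin n) (Fin n) R) : Matrix (Fin 2 × Fin n) (Fin 2 × Fin n) R :=
  Matrix.comp _ _ _ _ R !![e, 0; 0, g]

theorem cornerUnit_eq_diagPair : cornerUnit R n = diagPair 1 0 := by
  ext ⟨i, a⟩ ⟨j, b⟩
  fin_cases i <;> fin_cases j <;>
  simp [cornerUnit, diagPair, Matrix.diagonal_apply, Matrix.one_apply, Matrix.comp_apply]

/-- The splitting of `Fin 2 × Fin n` into its two halves. -/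
def halvesEquiv (n : ℕ) : Fin n ⊕ Fin n ≃ Fin 2 × Fin n :=
  (Equiv.boolProdEquivSum (Fin n)).symm.trans (finTwoEquiv.symm.prodCongr (Equiv.refl _))

theorem diagPair_submatrix (e g : Matrix (Fin n) (Fin n) R) :
    (diagPair e g).submatrix (halvesEquiv n) (halvesEquiv n) = blockSum e g := by
  ext (a | a) (b | b) <;> rfl

theorem diagPair_eq (e g : Matrix (Fin n) (Fin n) R) :
    diagPair e g = (blockSum e g).submatrix (halvesEquiv n).symm (halvesEquiv n).symm := by
  rw [← diagPair_submatrix, Matrix.submatrix_submatrix]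
  simp

variable [StarRing R]

theorem swapUnitary_mul_self {f : Matrix (Fin n) (Fin n) R} (hf : IsStarProjection f) :
    swapUnitary f * swapUnitary f = 1 := by
  have h : f * f = f := hf.isIdempotentElem
  rw [swapUnitary, Matrix.mul_fin_two, Matrix.one_fin_two]
  congr 1
  ext i j : 2
  fin_cases i <;> fin_cases j <;> simp <;> noncomm_ring <;> simp [h]

theorem conjTranspose_comp_swapUnitary {f : Matrix (Fin n) (Fin n) R} (hf : IsStarProjection f) :
    (Matrix.comp _ _ _ _ R (swapUnitary f))ᴴ = Matrix.comp _ _ _ _ R (swapUnitary f) := by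
  have h1 : star f = f := hf.isSelfAdjoint
  have h2 : star (1 - f) = 1 - f := hf.one_sub.isSelfAdjoint
  change Matrix.comp _ _ _ _ R (swapUnitary f)ᴴ = _
  congr 1
  ext i j : 1
  fin_cases i <;> fin_cases j <;> simp only [swapUnitary, Matrix.conjTranspose_apply] <;>
  first | exact h1 | exact h2

theorem isStarProjection_diagPair {e g : Matrix (Fin n) (Fin n) R} (he : IsStarProjection e)
    (hg : IsStarProjection g) : IsStarProjection (diagPair e g) := by
  rw [diagPair_eq]
  exact isStarProjection_submatrix (isStarProjection_blockSum he hg) _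

theorem projClass_diagPair {e g : Matrix (Fin n) (Fin n) R} (he : IsStarProjection e)
    (hg : IsStarProjection g) : projClass (diagPair e g) (isStarProjection_diagPair he hg) =
      projClass e he + projClass g hg := by
  rw [← projClass_blockSum he hg,
    ← projClass_submatrix (isStarProjection_blockSum he hg) (halvesEquiv n).symm]
  simp only [diagPair_eq]

theorem projClass_cornerUnit : projClass (cornerUnit R n) (isStarProjection_cornerUnit R n) =
    projClass (1 : Matrix (Fin n) (Fin n) R)
      (IsStarProjection.one (Matrix (Fin n) (Fin n) R)) := by
  have h := projClass_diagPair (IsStarProjection.one (Matrix (Fin n) (Fin n) R))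
    (IsStarProjection.zero (Matrix (Fin n) (Fin n) R))
  rw [projClass_zero, add_zero] at h
  rw [← h]
  simp only [cornerUnit_eq_diagPair]

/-- `w (e ⊕ (1 - f)) w`, for the self-adjoint unitary `w = swapUnitary f`. -/
def indexProj (e f : Matrix (Fin n) (Fin n) R) : Matrix (Fin 2 × Fin n) (Fin 2 × Fin n) R :=
  Matrix.comp _ _ _ _ R (swapUnitary f) * diagPair e (1 - f) *
    Matrix.comp _ _ _ _ R (swapUnitary f)

theorem comp_swapUnitary_mul_self {f : Matrix (Fin n) (Fin n) R} (hf : IsStarProjection f) :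
    Matrix.comp _ _ _ _ R (swapUnitary f) * Matrix.comp _ _ _ _ R (swapUnitary f) = 1 := by
  rw [← comp_mul, swapUnitary_mul_self hf, Matrix.comp_one]

theorem mvN_indexProj {e f : Matrix (Fin n) (Fin n) R} (he : IsStarProjection e)
    (hf : IsStarProjection f) : MvN (diagPair e (1 - f)) (indexProj e f) := by
  have hX := isStarProjection_diagPair he hf.one_sub
  have h1 : (diagPair e (1 - f))ᴴ = diagPair e (1 - f) := hX.isSelfAdjoint
  have h2 : diagPair e (1 - f) * diagPair e (1 - f) = diagPair e (1 - f) := hX.isIdempotentElem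
  have h3 := comp_swapUnitary_mul_self hf
  refine ⟨Matrix.comp _ _ _ _ R (swapUnitary f) * diagPair e (1 - f), ?_, ?_⟩
  · rw [Matrix.conjTranspose_mul, h1, conjTranspose_comp_swapUnitary hf, Matrix.mul_assoc,
      ← Matrix.mul_assoc _ _ (diagPair e (1 - f)), h3, Matrix.one_mul, h2]
  · rw [Matrix.conjTranspose_mul, h1, conjTranspose_comp_swapUnitary hf, Matrix.mul_assoc,
      ← Matrix.mul_assoc (diagPair e (1 - f)), h2, indexProj, Matrix.mul_assoc]

theorem isStarProjection_indexProj {e f : Matrix (Fin n) (Fin n) R} (he : IsStarProjection e)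
    (hf : IsStarProjection f) : IsStarProjection (indexProj e f) := by
  obtain ⟨v, h1, h2⟩ := mvN_indexProj he hf
  have hX := isStarProjection_diagPair he hf.one_sub
  have h3 := comp_swapUnitary_mul_self hf
  have h4 : diagPair e (1 - f) * diagPair e (1 - f) = diagPair e (1 - f) := hX.isIdempotentElem
  constructor
  · change indexProj e f * indexProj e f = indexProj e f
    simp only [indexProj, Matrix.mul_assoc]
    rw [← Matrix.mul_assoc (Matrix.comp _ _ _ _ R (swapUnitary f))
        (Matrix.comp _ _ _ _ R (swapUnitary f)), h3, Matrix.one_mul,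
      ← Matrix.mul_assoc (diagPair e (1 - f)) (diagPair e (1 - f)), h4]
  · change (indexProj e f)ᴴ = indexProj e f
    rw [← h2, Matrix.conjTranspose_mul, Matrix.conjTranspose_conjTranspose]

theorem projClass_indexProj_sub {e f : Matrix (Fin n) (Fin n) R} (he : IsStarProjection e)
    (hf : IsStarProjection f) :
    projClass (indexProj e f) (isStarProjection_indexProj he hf) -
      projClass (cornerUnit R n) (isStarProjection_cornerUnit R n) =
      projClass e he - projClass f hf := by
  rw [← projClass_eq_of_mvN (isStarProjection_diagPair he hf.one_sub)
    (isStarProjection_indexProj he hf) (mvN_indexProj he hf),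
    projClass_diagPair he hf.one_sub, projClass_one_sub hf, projClass_cornerUnit]
  abel

/-- Modulo `1 ⊕ 0`, the projection `w (e ⊕ (1 - f)) w` is `w ((e - f) ⊕ 0) w`. -/
theorem indexProj_sub_cornerUnit (e : Matrix (Fin n) (Fin n) R) {f : Matrix (Fin n) (Fin n) R}
    (hf : IsStarProjection f) : indexProj e f - cornerUnit R n =
      Matrix.comp _ _ _ _ R (Matrix.of fun i j => ![f, 1 - f] i * (e - f) * ![f, 1 - f] j) := by
  have h : f * f = f := hf.isIdempotentElem
  rw [cornerUnit_eq_diagPair, indexProj, diagPair, diagPair, ← comp_mul, ← comp_mul]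
  rw [← comp_sub]
  congr 1
  rw [swapUnitary, Matrix.mul_fin_two, Matrix.mul_fin_two]
  ext i j : 1
  fin_cases i <;> fin_cases j <;> simp <;> noncomm_ring <;> simp only [h] <;> abel

end

variable {B : Type*} [NonUnitalCStarAlgebra B]

/-- The index of the Cuntz pair of two matrix projections `e, f` over `B̃` is `[e] - [f]`. -/
theorem index_ofMatrix {n : ℕ} {e f : Matrix (Fin n) (Fin n) (Unitization ℂ B)}
    (he : IsStarProjection e) (hf : IsStarProjection f)
    (hef : ∀ i j, ∃ b : B, e i j - f i j = (b : Unitization ℂ B)) :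
    (CuntzPair.ofMatrix (e.map (toMult B)) (f.map (toMult B)) (isStarProjection_map_toMult he)
      (isStarProjection_map_toMult hf) fun i j => exists_coe_eq_sub (hef i j)).index =
      projClass e he - projClass f hf := by
  set a := CuntzPair.ofMatrix (e.map (toMult B)) (f.map (toMult B))
    (isStarProjection_map_toMult he) (isStarProjection_map_toMult hf)
    fun i j => exists_coe_eq_sub (hef i j) with ha
  have hP : a.leftOp = matOp e := rfl
  have hQ : a.rightOp = matOp f := rfl
  have hD : a.diffOp = matOp (e - f) := by rw [CuntzPair.diffOp, hP, hQ, matOp_sub]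
  have hB : ∀ i j, ((e - f) i j).fst = 0 := fun i j => by
    obtain ⟨b, hb⟩ := hef i j
    rw [Matrix.sub_apply, hb, Unitization.fst_inr]
  refine (a.isIndex_index).unique ⟨n, indexProj e f, isStarProjection_indexProj he hf,
    fun k l => ?_, fun i j => ?_, (projClass_indexProj_sub he hf).symm⟩
  · rw [indexProj_sub_cornerUnit e hf]
    change ((![f, 1 - f] k.1 * (e - f) * ![f, 1 - f] l.1) k.2 l.2).fst = 0
    rw [fst_matrix_mul]
    refine Finset.sum_eq_zero fun s _ => mul_eq_zero_of_left ?_ _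
    rw [fst_matrix_mul]
    exact Finset.sum_eq_zero fun s _ => mul_eq_zero_of_right _ (hB _ _)
  · have h1 : blockOp (indexProj e f - cornerUnit _ n) i j = a.blk i j := by
      rw [indexProj_sub_cornerUnit e hf]
      change matOp (![f, 1 - f] i * (e - f) * ![f, 1 - f] j) = _
      have hl : ∀ i, matOp (![f, 1 - f] i) * matOp (e - f) = a.split i * matOp (e - f) := by
        intro i
        fin_cases i
        · rfl
        · change matOp (1 - f) * matOp (e - f) = (1 - a.rightOp) * matOp (e - f)
          rw [hQ, sub_mul, one_mul, ← matOp_mul, ← matOp_mul, sub_mul, one_mul, matOp_sub]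
      have hr : ∀ i, matOp (e - f) * matOp (![f, 1 - f] i) = matOp (e - f) * a.split i := by
        intro i
        fin_cases i
        · rfl
        · change matOp (e - f) * matOp (1 - f) = matOp (e - f) * (1 - a.rightOp)
          rw [hQ, mul_sub, mul_one, ← matOp_mul, ← matOp_mul, mul_sub, mul_one, matOp_sub]
      rw [CuntzPair.blk, hD, matOp_mul, matOp_mul, hl, mul_assoc, hr, mul_assoc]
    rw [h1, sub_self, norm_zero]
    norm_num

/-- An element of `K₀(B)` is determined by the class in `KK_h(ℂ, B)` to which it corresponds. -/
theorem K0.Corresponds.unique {g g' : K0 B} {c : KKh B} (h : K0.Corresponds g c)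
    (h' : K0.Corresponds g' c) : g = g' := by
  obtain ⟨n, e, f, he, hf, hef, hg, hc⟩ := h
  obtain ⟨n', e', f', he', hf', hef', hg', hc'⟩ := h'
  refine Subtype.ext ?_
  rw [hg, hg', ← projClass_fin, ← projClass_fin, ← projClass_fin, ← projClass_fin,
    ← index_ofMatrix he hf hef, ← index_ofMatrix he' hf' hef']
  exact CuntzPair.index_eq_of_mk_eq (hc.symm.trans hc')

theorem K0.Corresponds.toK0_eq {g : K0 B} {c : KKh B} (h : K0.Corresponds g c) :
    KKh.toK0 c = g :=
  (Classical.epsilon_spec (p := fun g => K0.Corresponds g c) ⟨g, h⟩).unique h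

/-- The essential codimension of the images in `M(B)` of two projections `e, f` of `B̃` is
`[e] - [f]`. -/
theorem coe_essCodim {e f : Unitization ℂ B} (he : IsStarProjection e) (hf : IsStarProjection f)
    {b : B} (hb : e - f = (b : Unitization ℂ B)) {p q : 𝓜(ℂ, B)} (hp : IsStarProjection p)
    (hq : IsStarProjection q) (hpq : ∃ b : B, (b : 𝓜(ℂ, B)) = p - q)
    (hep : toMult B e = p) (hfq : toMult B f = q) :
    (essCodim p q hp hq hpq : K0Unital (Unitization ℂ B)) =
      K0Unital.ofProj e he - K0Unital.ofProj f hf := by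
  subst hep hfq
  have hsc : (scalarHom B) e = (scalarHom B) f := by
    rw [← sub_eq_zero, ← map_sub, hb]
    exact Unitization.fst_inr ℂ b
  have hmem : K0Unital.ofProj e he - K0Unital.ofProj f hf ∈ K0 B := by
    change K0Unital.map (scalarHom B) _ = 0
    rw [map_sub, sub_eq_zero, K0Unital.ofProj, K0Unital.ofProj, K0Unital.map_cls, K0Unital.map_cls]
    refine congrArg K0Unital.cls ?_
    simp only [MatProj.map, MatProj.mk.injEq, heq_eq_eq, true_and]
    ext i j
    exact hsc
  have h : K0.Corresponds ⟨_, hmem⟩ (kkClass (toMult B e) (toMult B f) hp hq hpq) :=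
    ⟨1, Matrix.of fun _ _ => e, Matrix.of fun _ _ => f, isStarProjection_one_by_one he,
      isStarProjection_one_by_one hf, fun _ _ => ⟨b, hb⟩, rfl, rfl⟩
  rw [essCodim, h.toK0_eq]

end KTheory

/-! ### Lifting projections from `M(B)` to `B̃` -/

namespace KTheory

variable {B : Type*} [NonUnitalCStarAlgebra B]

theorem coe_mult_injective {b b' : B} (h : (b : 𝓜(ℂ, B)) = (b' : 𝓜(ℂ, B))) : b = b' := by
  have h1 : ∀ a, b * a = b' * a := fun a =>
    congrArg (fun m : 𝓜(ℂ, B) => m.fst a) h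
  rw [← sub_eq_zero, ← CStarRing.mul_star_self_eq_zero_iff, sub_mul, h1, sub_self]

/-- `B̃ → M(B)` need not be injective (when `B` is unital), but `B̃ → M(B) ⊕ ℂ` is. -/
theorem ext_toMult {x y : Unitization ℂ B} (h : toMult B x = toMult B y) (h' : x.fst = y.fst) :
    x = y := by
  have h1 : x - y = (((x - y).snd : B) : Unitization ℂ B) := by
    refine Unitization.ext ?_ rfl
    rw [fst_sub, h', sub_self, Unitization.fst_inr]
  have h2 : (x - y).snd = 0 := by
    refine coe_mult_injective ?_
    rw [← toMult_inr, ← h1, map_sub, h, sub_self, ← toMult_inr, Unitization.inr_zero, map_zero]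
  rw [← sub_eq_zero, h1, h2, Unitization.inr_zero]

/-- A projection `f ∈ B̃` and a projection `p ∈ M(B)` which differs from the image of `f` by
`b ∈ B` give the projection `f + b ∈ B̃` lifting `p`: its scalar part is that of `f`. -/
theorem isStarProjection_add_inr {f : Unitization ℂ B} (hf : IsStarProjection f) {b : B}
    {p : 𝓜(ℂ, B)} (hp : IsStarProjection p) (hb : (b : 𝓜(ℂ, B)) = p - toMult B f) :
    toMult B (f + b) = p ∧ IsStarProjection (f + (b : Unitization ℂ B)) := by
  have h1 : toMult B (f + b) = p := by rw [map_add, toMult_inr, hb, add_sub_cancel]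
  have h2 : (f + (b : Unitization ℂ B)).fst = f.fst := by
    rw [Unitization.fst_add, Unitization.fst_inr, add_zero]
  refine ⟨h1, ?_, ?_⟩
  · refine ext_toMult ?_ ?_
    · rw [map_mul, h1, hp.isIdempotentElem.eq]
    · rw [Unitization.fst_mul, h2, ← Unitization.fst_mul, hf.isIdempotentElem.eq]
  · refine ext_toMult ?_ ?_
    · rw [map_star, h1, hp.isSelfAdjoint.star_eq]
    · rw [Unitization.fst_star, h2, ← Unitization.fst_star, hf.isSelfAdjoint.star_eq]

theorem isStarProjection_inr_iff {b : B} :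
    IsStarProjection (b : Unitization ℂ B) ↔ IsStarProjection b := by
  rw [isStarProjection_iff, isStarProjection_iff, IsIdempotentElem, IsIdempotentElem,
    IsSelfAdjoint, IsSelfAdjoint, ← Unitization.inr_mul, ← Unitization.inr_star,
    Unitization.inr_injective.eq_iff, Unitization.inr_injective.eq_iff]

theorem K0.coe_ofProj {b : B} (hb : IsStarProjection b) :
    (K0.ofProj b hb : K0Unital (Unitization ℂ B)) =
      K0Unital.ofProj (b : Unitization ℂ B) (isStarProjection_inr_iff.2 hb) := rfl

theorem K0.ofProj_mem_posCone {b : B} (hb : IsStarProjection b) : K0.ofProj b hb ∈ K0.posCone B :=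
  ⟨1, _, isStarProjection_one_by_one hb, rfl⟩

theorem K0Unital.ofProj_one_sub {R : Type*} [Ring R] [StarRing R] {e : R}
    (he : IsStarProjection e) : K0Unital.ofProj (1 - e) he.one_sub =
      K0Unital.ofProj 1 (IsStarProjection.one R) - K0Unital.ofProj e he := by
  have h := projClass_one_sub (isStarProjection_one_by_one he)
  have h1 : (1 : Matrix (Fin 1) (Fin 1) R) - Matrix.of (fun _ _ => e) =
      Matrix.of fun _ _ => 1 - e := by
    ext i j
    simp [Subsingleton.elim i j]
  have h2 : (1 : Matrix (Fin 1) (Fin 1) R) = Matrix.of fun _ _ => 1 := by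
    ext i j
    simp [Matrix.one_apply, Subsingleton.elim i j]
  simp only [projClass_fin, h1] at h
  simp only [h2] at h
  exact h

end KTheory

theorem mainTheorem8 {B : Type*} [NonUnitalCStarAlgebra B]
    [Preorder (KTheory.K0 B)] [IsOrderedAddMonoid (KTheory.K0 B)]
    (hcone : ∀ x : KTheory.K0 B, 0 ≤ x ↔ x ∈ KTheory.K0.posCone B)
    (p q : 𝓜(ℂ, B)) (hp : IsStarProjection p) (hq : IsStarProjection q)
    (hpq : ∃ b : B, (b : 𝓜(ℂ, B)) = p - q) :
    (∀ (q' : B) (hq' : IsStarProjection q'), (q' : 𝓜(ℂ, B)) = q →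
      KTheory.essCodim p q hp hq hpq ≥ -KTheory.K0.ofProj q' hq') ∧
    (∀ (r : B) (hr : IsStarProjection r), (r : 𝓜(ℂ, B)) = 1 - q →
      KTheory.essCodim p q hp hq hpq ≤ KTheory.K0.ofProj r hr) ∧
    (∀ (r : Unitization ℂ B) (hr : IsStarProjection r), KTheory.toMult B r = 1 - q →
      KTheory.K0Unital.ofProj r hr -
          (KTheory.essCodim p q hp hq hpq : KTheory.K0Unital (Unitization ℂ B)) ∈
        KTheory.K0Unital.posCone (Unitization ℂ B)) := by
  obtain ⟨b, hb⟩ := id hpq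
  -- a lift `f ∈ B̃` of `q` gives the lift `f + b` of `p`, hence the value of `[p : q]`
  have key : ∀ (f : Unitization ℂ B) (hf : IsStarProjection f), KTheory.toMult B f = q →
      ∃ he : IsStarProjection (f + (b : Unitization ℂ B)),
        (KTheory.essCodim p q hp hq hpq : KTheory.K0Unital (Unitization ℂ B)) =
          KTheory.K0Unital.ofProj (f + (b : Unitization ℂ B)) he -
            KTheory.K0Unital.ofProj f hf := fun f hf hfq => by
    obtain ⟨h1, he⟩ := KTheory.isStarProjection_add_inr hf hp (by rw [hfq]; exact hb)
    exact ⟨he, KTheory.coe_essCodim he hf (add_sub_cancel_left _ _) hp hq hpq h1 hfq⟩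
  refine ⟨fun q' hq' h => ?_, fun r hr h => ?_, fun r hr h => ?_⟩
  · obtain ⟨he, hess⟩ := key q' (KTheory.isStarProjection_inr_iff.2 hq')
      (by rw [KTheory.toMult_inr, h])
    simp only [← Unitization.inr_add] at he hess
    rw [ge_iff_le, neg_le_iff_add_nonneg, hcone]
    convert KTheory.K0.ofProj_mem_posCone (KTheory.isStarProjection_inr_iff.1 he)
    refine Subtype.ext ?_
    rw [AddSubgroup.coe_add, hess, KTheory.K0.coe_ofProj, KTheory.K0.coe_ofProj, sub_add_cancel]
  · have hr' := KTheory.isStarProjection_inr_iff.2 hr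
    obtain ⟨he, hess⟩ := key (1 - r) hr'.one_sub
      (by rw [map_sub, map_one, KTheory.toMult_inr, h, sub_sub_cancel])
    have h1 : (1 - (r : Unitization ℂ B) + b) = 1 - ((r - b : B) : Unitization ℂ B) := by
      rw [Unitization.inr_sub]; abel
    have hrb : IsStarProjection ((r - b : B) : Unitization ℂ B) := by
      have := he.one_sub
      rwa [h1, sub_sub_cancel] at this
    simp only [h1] at hess
    rw [KTheory.K0Unital.ofProj_one_sub hrb, KTheory.K0Unital.ofProj_one_sub hr'] at hess
    rw [← sub_nonneg, hcone]
    convert KTheory.K0.ofProj_mem_posCone (KTheory.isStarProjection_inr_iff.1 hrb)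
    refine Subtype.ext ?_
    rw [AddSubgroup.coe_sub, hess, KTheory.K0.coe_ofProj, KTheory.K0.coe_ofProj]
    abel
  · obtain ⟨he, hess⟩ := key (1 - r) hr.one_sub (by rw [map_sub, map_one, h, sub_sub_cancel])
    rw [hess, KTheory.K0Unital.ofProj_one_sub hr]
    refine ⟨⟨1, _, KTheory.isStarProjection_one_by_one he.one_sub⟩, ?_⟩
    change KTheory.K0Unital.ofProj _ he.one_sub = _
    rw [KTheory.K0Unital.ofProj_one_sub he]
    abel
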